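/- Let $A=\bigoplus_{i\in\mathbb Z}A_i$ be a commutative Noetherian $\mathbb Z$-graded ring which is graded local: it has exactly one maximal proper homogeneous ideal $\mathfrak m$. Let $k=A/\mathfrak m$ be the residue field (a graded field), and let $n$ be the Krull dimension of $A$, i.e. the supremum of the lengths of chains of homogeneous prime ideals. All modules are $\mathbb Z$-graded. Write $(\Sigma^bM)_i=M_{i-b}$, let $\mathrm{Hom}_A(M,N)$ be the graded module whose part of degree $d$ consists of the $A$-linear maps $M\to N$ raising degrees by $d$, and let $\mathrm{Ext}^i_A(M,N)$ be the graded module whose part of degree $d$ is the group $\mathrm{Ext}^i(M,\Sigma^{-d}N)$ in the abelian category of graded $A$-modules and degree-preserving maps. Suppose that $A$ is Gorenstein, in the sense that for some $b\in\mathbb Z$ $$\mathrm{Ext}^n_A(k,A)\cong\Sigma^bk\quad\text{and}\quad \mathrm{Ext}^i_A(k,A)=0\ \text{ for } i\neq n .$$ Let $I(k)$ be an injective hull of $k$ in the category of graded $A$-modules, and write $M^\vee=\mathrm{Hom}_A(M,I(k))$ for the Matlis dual of a graded module $M$. Let $M$ be a torsion graded $A$-module, i.e. every element of $M$ is annihilated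 by some power of $\mathfrak m$. Then $\mathrm{Ext}^i_A(M,A)=0$ for all $i\neq n$, and there is an isomorphism of graded $A$-modules $$\mathrm{Ext}^n_A(M,A)\cong\Sigma^bM^\vee .$$ -/

import Mathlib

open CategoryTheory CategoryTheory.Limits

universe u v w

/-- A `ℤ`-graded module over the `ℤ`-graded commutative ring `A = ⨁ 𝒜 i`: abelian groups
`obj j` (`j : ℤ`) with a biadditive, unital and associative multiplication
`𝒜 i × obj j → obj k` whenever `i + j = k`. -/
structure GrMod {A : Type u} [CommRing A] (𝒜 : ℤ → AddSubgroup A) [GradedRing 𝒜] where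
  obj : ℤ → Type v
  [grp : ∀ i, AddCommGroup (obj i)]
  act : ∀ {i j k : ℤ}, i + j = k → 𝒜 i →+ obj j →+ obj k
  one_act : ∀ {j : ℤ} (h : 0 + j = j) (x : obj j),
    act h ⟨1, SetLike.GradedOne.one_mem⟩ x = x
  mul_act : ∀ {i j k l p : ℤ} (h₁ : j + k = l) (h₂ : i + l = p) (h₃ : (i + j) + k = p)
    (a : 𝒜 i) (b : 𝒜 j) (x : obj k),
    act h₃ ⟨(a : A) * b, SetLike.GradedMul.mul_mem a.2 b.2⟩ x = act h₂ a (act h₁ b x)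

namespace GrMod

variable {A : Type u} [CommRing A] {𝒜 : ℤ → AddSubgroup A} [GradedRing 𝒜]

instance (M : GrMod.{u, v} 𝒜) (i : ℤ) : AddCommGroup (M.obj i) := M.grp i

/-- Morphisms of graded modules: `A`-linear maps of degree `0`. -/
@[ext]
structure Hom (M N : GrMod.{u, v} 𝒜) where
  app : ∀ i : ℤ, M.obj i →+ N.obj i
  map_act : ∀ {i j k : ℤ} (h : i + j = k) (a : 𝒜 i) (x : M.obj j),
    app k (M.act h a x) = N.act h a (app j x)

instance : Category (GrMod.{u, v} 𝒜) where
  Hom := Hom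
  id M := ⟨fun _ => AddMonoidHom.id _, fun _ _ _ => rfl⟩
  comp f g := ⟨fun i => (g.app i).comp (f.app i), fun h a x => by
    simp [f.map_act, g.map_act]⟩

section Hom

variable {M N P : GrMod.{u, v} 𝒜}

@[ext]
theorem hom_ext {f g : M ⟶ N} (h : ∀ i (x : M.obj i), f.app i x = g.app i x) : f = g :=
  Hom.ext (funext fun i => AddMonoidHom.ext (h i))

@[simp] theorem id_app (i : ℤ) (x : M.obj i) : Hom.app (𝟙 M) i x = x := rfl

@[simp] theorem comp_app (f : M ⟶ N) (g : N ⟶ P) (i : ℤ) (x : M.obj i) :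
    (f ≫ g).app i x = g.app i (f.app i x) := rfl

theorem hom_act (f : M ⟶ N) {i j k : ℤ} (h : i + j = k) (a : 𝒜 i) (x : M.obj j) :
    f.app k (M.act h a x) = N.act h a (f.app j x) := f.map_act h a x

instance : Zero (M ⟶ N) := ⟨⟨fun _ => 0, fun _ _ _ => by simp⟩⟩
instance : Add (M ⟶ N) := ⟨fun f g => ⟨fun i => f.app i + g.app i, fun h a x => by
  simp [hom_act]⟩⟩
instance : Neg (M ⟶ N) := ⟨fun f => ⟨fun i => -f.app i, fun h a x => by simp [hom_act]⟩⟩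
instance : Sub (M ⟶ N) := ⟨fun f g => ⟨fun i => f.app i - g.app i, fun h a x => by
  simp [hom_act]⟩⟩
instance : SMul ℕ (M ⟶ N) := ⟨fun n f => ⟨fun i => n • f.app i, fun h a x => by
  simp [hom_act]⟩⟩
instance : SMul ℤ (M ⟶ N) := ⟨fun n f => ⟨fun i => n • f.app i, fun h a x => by
  simp [hom_act]⟩⟩

theorem app_injective : Function.Injective (fun f : M ⟶ N => Hom.app f) :=
  fun _ _ h => Hom.ext h

instance : AddCommGroup (M ⟶ N) :=
  app_injective.addCommGroup _ rfl (fun _ _ => rfl) (fun _ => rfl) (fun _ _ => rfl)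
    (fun _ _ => rfl) (fun _ _ => rfl)

@[simp] theorem zero_app (i : ℤ) (x : M.obj i) : Hom.app (0 : M ⟶ N) i x = 0 := rfl
@[simp] theorem add_app (f g : M ⟶ N) (i : ℤ) (x : M.obj i) :
    (f + g).app i x = f.app i x + g.app i x := rfl

end Hom

instance : Preadditive (GrMod.{u, v} 𝒜) where
  add_comp _ _ _ f g h := by ext i x; simp
  comp_add _ _ _ f g h := by ext i x; simp

/-! ### Products, kernels and cokernels, formed degreewise -/

/-- The product of a family of graded modules. -/
def pi {J : Type} (M : J → GrMod.{u, v} 𝒜) : GrMod.{u, v} 𝒜 where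
  obj i := ∀ j, (M j).obj i
  act h := AddMonoidHom.mk' (fun a => AddMonoidHom.mk' (fun x j => (M j).act h a (x j))
    (fun x y => by ext j; simp)) (fun a b => by ext x j; simp)
  one_act h x := by ext j; exact (M j).one_act h (x j)
  mul_act h₁ h₂ h₃ a b x := by ext j; exact (M j).mul_act h₁ h₂ h₃ a b (x j)

/-- The morphism to the product induced by a family of morphisms. -/
def piLift {J : Type} (M : J → GrMod.{u, v} 𝒜) {W : GrMod.{u, v} 𝒜} (g : ∀ j, W ⟶ M j) :
    W ⟶ pi M :=
  (⟨fun i => AddMonoidHom.mk' (fun x j => (g j).app i x) (fun x y => funext fun j => map_add _ x y),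
    fun h a x => by
      refine funext fun j => ?_
      exact hom_act (g j) h a x⟩ : Hom W (pi M))

instance : HasFiniteProducts (GrMod.{u, v} 𝒜) := by
  refine ⟨fun n => ⟨fun K => ?_⟩⟩
  let F : Fin n → GrMod.{u, v} 𝒜 := fun j => K.obj ⟨j⟩
  have : HasLimit (Discrete.functor F) := ⟨⟨⟨
    Fan.mk (pi F) (fun j => (⟨fun i => Pi.evalAddMonoidHom _ j, fun _ _ _ => rfl⟩ : Hom _ _)),
    Fan.IsLimit.mk _
      (fun s => piLift F s.proj)
      (fun s j => rfl)
      (fun s m hm => by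
        ext i x
        funext j
        exact congrArg (fun f : s.pt ⟶ F j => f.app i x) (hm j))⟩⟩⟩
  exact hasLimit_of_iso (Discrete.natIso (fun ⟨j⟩ => Iso.refl _) : Discrete.functor F ≅ K)

section Kernels

variable {M N : GrMod.{u, v} 𝒜} (f : M ⟶ N)

/-- The kernel of a morphism. -/
def ker : GrMod.{u, v} 𝒜 where
  obj i := (f.app i).ker
  act {i j k} h := AddMonoidHom.mk' (fun a => AddMonoidHom.mk'
      (fun x => ⟨M.act h a x, by
        have := x.2
        rw [AddMonoidHom.mem_ker] at this ⊢
        rw [hom_act, this, map_zero]⟩)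
      (fun x y => by ext; simp)) (fun a b => by ext x; simp)
  one_act h x := Subtype.ext (M.one_act h x.1)
  mul_act h₁ h₂ h₃ a b x := Subtype.ext (M.mul_act h₁ h₂ h₃ a b x.1)

/-- The inclusion of the kernel. -/
def kerι : ker f ⟶ M := (⟨fun i => (f.app i).ker.subtype, fun _ _ _ => rfl⟩ : Hom _ _)

theorem kerι_comp : kerι f ≫ f = 0 := by ext i x; exact x.2

/-- Lifting a morphism to the kernel. -/
def kerLift {W : GrMod.{u, v} 𝒜} (g : W ⟶ M) (h : g ≫ f = 0) : W ⟶ ker f :=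
  (⟨fun i => (g.app i).codRestrict _ (fun x =>
      congrArg (fun q : W ⟶ N => q.app i x) h),
    fun h a x => Subtype.ext (hom_act g h a x)⟩ : Hom _ _)

/-- `kerι f` is a kernel of `f`. -/
def kerIsLimit : IsLimit (KernelFork.ofι (kerι f) (kerι_comp f)) :=
  KernelFork.IsLimit.ofι _ _ (fun g h => kerLift f g h) (fun _ _ => rfl)
    (fun g h m hm => by
      ext i x
      exact Subtype.ext (congrArg (fun q : _ ⟶ M => q.app i x) hm))

/-- The cokernel of a morphism. -/
def coker : GrMod.{u, v} 𝒜 where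
  obj i := N.obj i ⧸ (f.app i).range
  act {i j k} h := AddMonoidHom.mk' (fun a => QuotientAddGroup.map _ _ (N.act h a) (by
      rintro _ ⟨x, rfl⟩
      exact ⟨M.act h a x, hom_act f h a x⟩)) (fun a b => by
      ext x
      simp)
  one_act h x := by
    obtain ⟨x, rfl⟩ := QuotientAddGroup.mk_surjective x
    exact congrArg _ (N.one_act h x)
  mul_act h₁ h₂ h₃ a b x := by
    obtain ⟨x, rfl⟩ := QuotientAddGroup.mk_surjective x
    exact congrArg _ (N.mul_act h₁ h₂ h₃ a b x)

/-- The projection to the cokernel. -/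
def cokerπ : N ⟶ coker f :=
  (⟨fun i => QuotientAddGroup.mk' (f.app i).range, fun _ _ _ => rfl⟩ : Hom _ _)

theorem comp_cokerπ : f ≫ cokerπ f = 0 := by
  ext i x
  exact (QuotientAddGroup.eq_zero_iff _).2 ⟨x, rfl⟩

/-- Descending a morphism to the cokernel. -/
def cokerDesc {W : GrMod.{u, v} 𝒜} (g : N ⟶ W) (h : f ≫ g = 0) : coker f ⟶ W :=
  (⟨fun i => QuotientAddGroup.lift _ (g.app i) (by
      rintro _ ⟨x, rfl⟩
      exact congrArg (fun q : M ⟶ W => q.app i x) h),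
    fun h a x => by
      obtain ⟨x, rfl⟩ := QuotientAddGroup.mk_surjective x
      exact hom_act g h a x⟩ : Hom _ _)

/-- `cokerπ f` is a cokernel of `f`. -/
def cokerIsColimit : IsColimit (CokernelCofork.ofπ (cokerπ f) (comp_cokerπ f)) :=
  CokernelCofork.IsColimit.ofπ _ _ (fun g h => cokerDesc f g h) (fun _ _ => rfl)
    (fun g h m hm => by
      ext i x
      obtain ⟨x, rfl⟩ := QuotientAddGroup.mk_surjective x
      exact congrArg (fun q : N ⟶ _ => q.app i x) hm)

instance : HasKernels (GrMod.{u, v} 𝒜) := ⟨fun f => ⟨⟨⟨_, kerIsLimit f⟩⟩⟩⟩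

instance : HasCokernels (GrMod.{u, v} 𝒜) := ⟨fun f => ⟨⟨⟨_, cokerIsColimit f⟩⟩⟩⟩

theorem injective_of_mono [Mono f] (i : ℤ) : Function.Injective (f.app i) := by
  rw [injective_iff_map_eq_zero]
  intro x hx
  have h : kerι f = 0 := by
    rw [← cancel_mono f, kerι_comp, zero_comp]
  exact congrArg (fun q : ker f ⟶ M => q.app i ⟨x, hx⟩) h

theorem surjective_of_epi [Epi f] (i : ℤ) : Function.Surjective (f.app i) := by
  intro y
  have h : cokerπ f = 0 := by
    rw [← cancel_epi f, comp_cokerπ, comp_zero]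
  exact (QuotientAddGroup.eq_zero_iff y).1 (congrArg (fun q : N ⟶ coker f => q.app i y) h)

/-- Every monomorphism is the kernel of its cokernel. -/
theorem nonempty_normalMono [Mono f] : Nonempty (NormalMono f) := Nonempty.intro <|
  { Z := coker f
    g := cokerπ f
    w := comp_cokerπ f
    isLimit := by
      have key : ∀ {W : GrMod.{u, v} 𝒜} (g : W ⟶ N), g ≫ cokerπ f = 0 →
          ∀ (i : ℤ) (x : W.obj i), ∃ y, f.app i y = g.app i x := fun g h i x =>
        (QuotientAddGroup.eq_zero_iff _).1 (congrArg (fun q : _ ⟶ coker f => q.app i x) h)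
      refine KernelFork.IsLimit.ofι _ _ (fun {W} g h => (⟨fun i =>
        AddMonoidHom.mk' (fun x => (key g h i x).choose) fun x y => ?_, fun {i j k} e a x => ?_⟩ :
          Hom W M)) (fun g h => ?_) (fun g h m hm => ?_)
      · apply injective_of_mono f i
        rw [(key g h i _).choose_spec, map_add, map_add, (key g h i x).choose_spec,
          (key g h i y).choose_spec]
      · apply injective_of_mono f k
        rw [hom_act]
        exact (key g h k _).choose_spec.trans ((hom_act g e a x).trans
          (congrArg _ (key g h j x).choose_spec.symm))
      · ext i x
        exact (key g h i x).choose_spec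
      · ext i x
        apply injective_of_mono f i
        exact (congrArg (fun q : _ ⟶ N => q.app i x) hm).trans (key g h i x).choose_spec.symm }

/-- Every epimorphism is the cokernel of its kernel. -/
theorem nonempty_normalEpi [Epi f] : Nonempty (NormalEpi f) := Nonempty.intro <|
  { W := ker f
    g := kerι f
    w := kerι_comp f
    isColimit := by
      have key : ∀ {W : GrMod.{u, v} 𝒜} (g : M ⟶ W), kerι f ≫ g = 0 →
          ∀ (i : ℤ) (x y : M.obj i), f.app i x = f.app i y → g.app i x = g.app i y := by
        intro W g h i x y hxy
        rw [← sub_eq_zero, ← map_sub]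
        exact congrArg (fun q : ker f ⟶ W => q.app i ⟨x - y, by
          rw [AddMonoidHom.mem_ker, map_sub, hxy, sub_self]⟩) h
      have sec : ∀ (i : ℤ) (y : N.obj i), ∃ x, f.app i x = y := fun i => surjective_of_epi f i
      refine CokernelCofork.IsColimit.ofπ _ _ (fun {W} g h => (⟨fun i =>
        AddMonoidHom.mk' (fun y => g.app i (sec i y).choose) fun x y => ?_, fun {i j k} e a x => ?_⟩ :
          Hom N W)) (fun g h => ?_) (fun g h m hm => ?_)
      · rw [← map_add]
        apply key g h
        rw [(sec i _).choose_spec, map_add, (sec i x).choose_spec, (sec i y).choose_spec]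
      · refine Eq.trans ?_ (hom_act g e a _)
        apply key g h
        rw [hom_act, (sec j x).choose_spec]
        exact (sec k _).choose_spec
      · ext i x
        apply key g h
        exact (sec i _).choose_spec
      · ext i y
        refine Eq.trans ?_ (congrArg (fun q : M ⟶ _ => q.app i (sec i y).choose) hm)
        exact congrArg (m.app i) (sec i y).choose_spec.symm }

end Kernels

noncomputable instance : Abelian (GrMod.{u, v} 𝒜) where
  normalMonoOfMono f _ := nonempty_normalMono f
  normalEpiOfEpi f _ := nonempty_normalEpi f

instance : HasExt.{max u (v + 1)} (GrMod.{u, v} 𝒜) := HasExt.standard _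

/-! ### Suspensions, graded `Hom` and graded `Ext` -/

/-- The suspension `Σ^b M`, with `(Σ^b M)_i = M_{i - b}`. -/
def shift (b : ℤ) (M : GrMod.{u, v} 𝒜) : GrMod.{u, v} 𝒜 where
  obj i := M.obj (i - b)
  act {i j k} h := M.act (show i + (j - b) = k - b by omega)
  one_act _ x := M.one_act _ x
  mul_act _ _ _ a b x := M.mul_act _ _ _ a b x

/-- Multiplication by `a ∈ 𝒜 e`, as a morphism `Σ^{-d} N ⟶ Σ^{-d'} N` for `e + d = d'`. -/
def mulHom (N : GrMod.{u, v} 𝒜) {e d d' : ℤ} (h : e + d = d') (a : 𝒜 e) :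
    shift (-d) N ⟶ shift (-d') N :=
  (⟨fun i => N.act (show e + (i - -d) = i - -d' by omega) a, fun {i j k} e' c x => by
    have h₃ : i + e + (j - -d) = k - -d' := by omega
    have h₄ : e + i + (j - -d) = k - -d' := by omega
    refine (N.mul_act _ _ h₄ a c x).symm.trans
      (Eq.trans ?_ (N.mul_act _ _ h₃ c a x))
    have : ∀ {p q : ℤ} (hpq : p = q) (hp : p + (j - -d) = k - -d') (hq : q + (j - -d) = k - -d')
        (y : 𝒜 p) (z : 𝒜 q), (y : A) = z → N.act hp y x = N.act hq z x := by
      rintro p _ rfl hp hq y z hyz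
      rw [Subtype.ext hyz]
    exact this (add_comm _ _) _ _ _ _ (mul_comm _ _)⟩ : Hom _ _)

theorem mulHom_add (N : GrMod.{u, v} 𝒜) {e d d' : ℤ} (h : e + d = d') (a b : 𝒜 e) :
    mulHom N h (a + b) = mulHom N h a + mulHom N h b := by
  ext i x
  exact congrArg (fun q : N.obj (i - -d) →+ N.obj (i - -d') => q x)
    (map_add (N.act (show e + (i - -d) = i - -d' by omega)) a b)

theorem mulHom_one (N : GrMod.{u, v} 𝒜) {d : ℤ} (h : 0 + d = d) :
    mulHom N h ⟨1, SetLike.GradedOne.one_mem⟩ = 𝟙 (shift (-d) N) := by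
  ext i x
  exact N.one_act _ x

theorem mulHom_mul (N : GrMod.{u, v} 𝒜) {i j k l p : ℤ} (h₁ : j + k = l) (h₂ : i + l = p)
    (h₃ : (i + j) + k = p) (a : 𝒜 i) (b : 𝒜 j) :
    mulHom N h₃ ⟨(a : A) * b, SetLike.GradedMul.mul_mem a.2 b.2⟩ =
      mulHom N h₁ b ≫ mulHom N h₂ a := by
  ext t x
  exact N.mul_act _ _ _ a b x

/-- The graded module `Hom_A(M, N)`. Its part of degree `d` consists of the `A`-linear maps
raising degrees by `d`, that is, of the morphisms `M ⟶ Σ^{-d} N`. -/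
def gradedHom (M N : GrMod.{u, v} 𝒜) : GrMod.{u, v} 𝒜 where
  obj d := M ⟶ shift (-d) N
  act h := AddMonoidHom.mk' (fun a => AddMonoidHom.mk' (fun f => f ≫ mulHom N h a)
    (fun f g => Preadditive.add_comp _ _ _ f g _))
    (fun a b => AddMonoidHom.ext fun f => (congrArg (f ≫ ·) (mulHom_add N h a b)).trans
      (Preadditive.comp_add _ _ _ f _ _))
  one_act h f := (congrArg (f ≫ ·) (mulHom_one N h)).trans (Category.comp_id f)
  mul_act h₁ h₂ h₃ a b f := (congrArg (f ≫ ·) (mulHom_mul N h₁ h₂ h₃ a b)).trans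
    (Category.assoc _ _ _).symm

/-- The graded module `Ext^i_A(M, N)`. Its part of degree `d` is the `i`-th `Ext` group of `M` and
`Σ^{-d} N` in the abelian category of graded modules, and `A` acts through `N`. -/
noncomputable def gradedExt (i : ℕ) (M N : GrMod.{u, v} 𝒜) : GrMod.{u, max u (v + 1)} 𝒜 where
  obj d := Abelian.Ext M (shift (-d) N) i
  act h := AddMonoidHom.mk' (fun a => AddMonoidHom.mk'
      (fun α => α.comp (Abelian.Ext.mk₀ (mulHom N h a)) (add_zero i))
      (fun α β => Abelian.Ext.add_comp α β _ _))
    (fun a b => by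
      ext1 α
      simp [mulHom_add, Abelian.Ext.mk₀_add])
  one_act h α := by simp [mulHom_one]
  mul_act h₁ h₂ h₃ a b α := by simp [mulHom_mul N h₁ h₂ h₃ a b]

/-- An isomorphism of graded modules (whose underlying types may lie in different universes). -/
structure Equiv (M : GrMod.{u, v} 𝒜) (N : GrMod.{u, w} 𝒜) where
  app : ∀ i : ℤ, M.obj i ≃+ N.obj i
  map_act : ∀ {i j k : ℤ} (h : i + j = k) (a : 𝒜 i) (x : M.obj j),
    app k (M.act h a x) = N.act h a (app j x)

/-! ### Graded local rings, torsion modules, injective hulls -/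

/-- The graded module with homogeneous parts `ℳ i`, where `ℳ` is a family of subgroups of an
`A`-module with `𝒜 i • ℳ j ⊆ ℳ (i + j)`. -/
def ofGraded (𝒜 : ℤ → AddSubgroup A) [GradedRing 𝒜] {M : Type v} [AddCommGroup M] [Module A M]
    (ℳ : ℤ → AddSubgroup M) (hℳ : ∀ {i j : ℤ} {a : A} {x : M}, a ∈ 𝒜 i → x ∈ ℳ j →
      a • x ∈ ℳ (i + j)) : GrMod.{u, v} 𝒜 where
  obj i := ℳ i
  act h := AddMonoidHom.mk' (fun a => AddMonoidHom.mk'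
      (fun x => ⟨(a : A) • (x : M), h ▸ hℳ a.2 x.2⟩)
      (fun x y => by ext; simp)) (fun a b => by ext x; simp [add_smul])
  one_act _ x := by ext; simp
  mul_act _ _ _ a b x := by ext; simp [mul_smul]

/-- The ring `A` as a graded module over itself. -/
def self (𝒜 : ℤ → AddSubgroup A) [GradedRing 𝒜] : GrMod.{u, u} 𝒜 :=
  ofGraded 𝒜 𝒜 fun ha hx => SetLike.GradedMul.mul_mem ha hx

/-- The graded module `A ⧸ I`, whose part of degree `i` is the image of `𝒜 i`. -/
def quotient (I : HomogeneousIdeal 𝒜) : GrMod.{u, u} 𝒜 :=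
  ofGraded 𝒜 (fun i => (𝒜 i).map (Ideal.Quotient.mk I.toIdeal).toAddMonoidHom) (by
    rintro i j a _ ha ⟨x, hx, rfl⟩
    exact ⟨a * x, SetLike.GradedMul.mul_mem ha hx, rfl⟩)

/-- `M` is torsion if each of its elements is annihilated by some power of the ideal `𝔪`. -/
def IsTorsion (𝔪 : HomogeneousIdeal 𝒜) (M : GrMod.{u, v} 𝒜) : Prop :=
  ∀ (j : ℤ) (x : M.obj j), ∃ s : ℕ, ∀ {i k : ℤ} (h : i + j = k) (a : 𝒜 i),
    (a : A) ∈ 𝔪.toIdeal ^ s → M.act h a x = 0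

/-- `ι : K ⟶ I` is an injective hull in the category of graded modules: `I` is injective and
`ι` is an essential monomorphism. -/
structure IsInjectiveHull {K I : GrMod.{u, v} 𝒜} (ι : K ⟶ I) : Prop where
  injective : Injective I
  mono : Mono ι
  essential : ∀ {Z : GrMod.{u, v} 𝒜} (g : I ⟶ Z), Mono (ι ≫ g) → Mono g

/-- The Matlis dual `M^∨ = Hom_A(M, I)`, where `I` is an injective hull of the residue field. -/
abbrev matlisDual (I M : GrMod.{u, v} 𝒜) : GrMod.{u, v} 𝒜 := gradedHom M I

end GrMod

section

variable {A : Type u} [CommRing A] {𝒜 : ℤ → AddSubgroup A} [GradedRing 𝒜]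

/-- The graded ring is local with maximal ideal `𝔪`: among the proper homogeneous ideals there is
exactly one maximal one, namely `𝔪`. -/
def IsGradedLocal (𝔪 : HomogeneousIdeal 𝒜) : Prop :=
  IsCoatom 𝔪 ∧ ∀ 𝔫 : HomogeneousIdeal 𝒜, IsCoatom 𝔫 → 𝔫 = 𝔪

variable (𝒜) in
/-- The Krull dimension of a graded ring: the supremum of the lengths of chains of homogeneous
prime ideals. -/
noncomputable def gradedKrullDim : WithBot ℕ∞ :=
  Order.krullDim {𝔭 : HomogeneousIdeal 𝒜 // 𝔭.toIdeal.IsPrime}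

/-- The graded local ring with residue field `k = A ⧸ 𝔪` is Gorenstein of Krull dimension `n`, with
`Ext^n_A(k, A) ≅ Σ^b k` and `Ext^i_A(k, A) = 0` for `i ≠ n`. -/
structure IsGradedGorenstein (𝔪 : HomogeneousIdeal 𝒜) (n : ℕ) (b : ℤ) : Prop where
  krullDim : gradedKrullDim 𝒜 = n
  ext_eq_zero : ∀ i : ℕ, i ≠ n → ∀ d : ℤ,
    Subsingleton ((GrMod.gradedExt i (GrMod.quotient 𝔪) (GrMod.self 𝒜)).obj d)
  ext_equiv : Nonempty (GrMod.Equiv (GrMod.gradedExt n (GrMod.quotient 𝔪) (GrMod.self 𝒜))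
    (GrMod.shift b (GrMod.quotient 𝔪)))

end

/-!
The proof rests on two elementary facts: homogeneous elements outside `𝔪` are invertible modulo `𝔪`
(`GrMod.exists_mul_add_eq_one`), and every nonzero torsion module contains a suspension of the
residue field `k` (`GrMod.IsTorsionElement.exists_inSocle`: multiply an element by homogeneous
elements of the largest power of `𝔪` that does not annihilate it). They replace the decomposition of
injective modules into indecomposable ones.

*Vanishing.* If `Ext^i(k, Σ^{-d} X) = 0` for all `d`, then `Ext^i(M, Σ^{-d} X) = 0` for all torsion
modules `M` (`GrMod.subsingleton_ext_of_isTorsion`). Embedding `X` into an injective module reduces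
this to `i ≤ 1`. For `i = 0` it holds because the image of a nonzero morphism from `M` would contain
a suspension of `k`. For `i = 1` one has to lift morphisms `M ⟶ Z` along `I ⟶ Z`, where
`0 ⟶ X ⟶ I ⟶ Z ⟶ 0` is exact; a maximal partial lift is total, because the quotient of `M` by its
domain would otherwise contain a suspension of `k`, onto which the lift could be extended
(`GrMod.exists_lift_of_extends`).

*Representability.* If `Ext^i(k, Σ^{-d} X)` vanishes for `i ≠ n`, there is a module `Y` with a class
in `Ext^n(Y, X)` which induces `Hom(M, Y) ≅ Ext^n(M, X)` for all torsion modules `M`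
(`GrMod.exists_universal_class`). This is an induction on `n`: for `n > 0` the module `X` has no
socle, hence neither has its injective hull `J` (`GrMod.exists_injective_essential`), so that all
`Ext^i(M, J)`, including `Hom(M, J)`, vanish, and `X` may be replaced by `J ⧸ X`. By construction
`Ext^1(M, Y) = 0` for all torsion modules `M`.

*Identification.* For `X = A` the Gorenstein condition says that `Hom(k, Y) ≅ Σ^b k`, so that the
socle of `Y` is `Σ^b k`. The resulting morphism `Σ^b k ⟶ Y` and the injectivity of `Σ^b I` give a
morphism `Y ⟶ Σ^b I` which identifies the socles (`GrMod.exists_identifiesSocles`). As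
`Ext^1(M, Y) = 0` and `I` is an essential extension of `k`, it induces `Hom(M, Y) ≅ Hom(M, Σ^b I)`
for torsion modules `M` (`GrMod.IdentifiesSocles.bijective_comp`).
-/

namespace GrMod

variable {A : Type u} [CommRing A] {𝒜 : ℤ → AddSubgroup A} [GradedRing 𝒜]

/-! ### Elementwise constructions of morphisms -/

theorem act_congr (M : GrMod.{u, v} 𝒜) {p q j k : ℤ} (hp : p + j = k) (hq : q + j = k)
    {a : 𝒜 p} {b : 𝒜 q} (h : (a : A) = b) (x : M.obj j) : M.act hp a x = M.act hq b x := by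
  obtain rfl : p = q := by omega
  rw [Subtype.ext h]

theorem act_act (M : GrMod.{u, v} 𝒜) {i j k l : ℤ} (h₁ : j + k = l) {p : ℤ} (h₂ : i + l = p)
    (a : 𝒜 i) (b : 𝒜 j) (x : M.obj k) :
    M.act h₂ a (M.act h₁ b x) =
      M.act (show (i + j) + k = p by omega)
        ⟨(a : A) * b, SetLike.GradedMul.mul_mem a.2 b.2⟩ x :=
  (M.mul_act h₁ h₂ _ a b x).symm

/-- The unit of the ring, as an element of degree `0`. Acting by it serves as the transport between
`M.obj j` and `M.obj k` for provably equal degrees. -/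
def one (𝒜 : ℤ → AddSubgroup A) [GradedRing 𝒜] : 𝒜 0 := ⟨1, SetLike.GradedOne.one_mem⟩

theorem act_one_act (M : GrMod.{u, v} 𝒜) {i j k p : ℤ} (h₁ : i + j = k) (h₂ : 0 + k = p)
    (h₃ : i + j = p) (a : 𝒜 i) (x : M.obj j) : M.act h₂ (one 𝒜) (M.act h₁ a x) = M.act h₃ a x := by
  rw [act_act]
  exact M.act_congr _ _ (one_mul _) x

theorem act_act_one (M : GrMod.{u, v} 𝒜) {i j k p : ℤ} (h₁ : 0 + j = k) (h₂ : i + k = p)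
    (h₃ : i + j = p) (a : 𝒜 i) (x : M.obj j) : M.act h₂ a (M.act h₁ (one 𝒜) x) = M.act h₃ a x := by
  rw [act_act]
  exact M.act_congr _ _ (mul_one _) x

theorem act_one (M : GrMod.{u, v} 𝒜) {j : ℤ} (h : 0 + j = j) (x : M.obj j) :
    M.act h (one 𝒜) x = x := M.one_act h x

theorem act_one_injective (M : GrMod.{u, v} 𝒜) {j k : ℤ} (h : 0 + j = k) :
    Function.Injective (M.act h (one 𝒜)) := by
  obtain rfl : j = k := by omega
  intro x y hxy
  rwa [act_one, act_one] at hxy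

section

variable {M N P Q W X Y : GrMod.{u, v} 𝒜}

/-- A morphism whose values lie in the image of an injective morphism `f` factors through `f`. -/
noncomputable def liftOfInjective (f : X ⟶ Y) (hf : ∀ i, Function.Injective (f.app i)) (g : W ⟶ Y)
    (h : ∀ i x, ∃ y, f.app i y = g.app i x) : W ⟶ X :=
  (⟨fun i => AddMonoidHom.mk' (fun x => (h i x).choose) fun x y => hf i (by
      refine (h i _).choose_spec.trans ?_
      rw [map_add, map_add, (h i x).choose_spec, (h i y).choose_spec]),
    fun {i j k} e a x => hf k ((h k _).choose_spec.trans (by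
      rw [hom_act, hom_act]
      exact congrArg _ (h j x).choose_spec.symm))⟩ : Hom W X)

theorem liftOfInjective_spec (f : X ⟶ Y) (hf : ∀ i, Function.Injective (f.app i)) (g : W ⟶ Y)
    (h : ∀ i x, ∃ y, f.app i y = g.app i x) (i : ℤ) (x : W.obj i) :
    f.app i ((liftOfInjective f hf g h).app i x) = g.app i x := (h i x).choose_spec

/-- A morphism vanishing on the kernel of a surjective morphism `p` factors through `p`. -/
noncomputable def descOfSurjective (p : P ⟶ Q) (hp : ∀ i, Function.Surjective (p.app i)) (g : P ⟶ W)
    (h : ∀ i x, p.app i x = 0 → g.app i x = 0) : Q ⟶ W :=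
  have key : ∀ i x y, p.app i x = p.app i y → g.app i x = g.app i y := fun i x y hxy => by
    rw [← sub_eq_zero, ← map_sub]
    exact h i _ (by rw [map_sub, hxy, sub_self])
  (⟨fun i => AddMonoidHom.mk' (fun x => g.app i (hp i x).choose) fun x y => by
      rw [← map_add]
      apply key
      rw [(hp i _).choose_spec, map_add, (hp i x).choose_spec, (hp i y).choose_spec],
    fun {i j k} e a x => Eq.trans (key k _ _ (by
      rw [hom_act, (hp k _).choose_spec, (hp j x).choose_spec])) (hom_act g e a _)⟩ : Hom Q W)

theorem descOfSurjective_app (p : P ⟶ Q) (hp : ∀ i, Function.Surjective (p.app i)) (g : P ⟶ W)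
    (h : ∀ i x, p.app i x = 0 → g.app i x = 0) (i : ℤ) (x : P.obj i) :
    (descOfSurjective p hp g h).app i (p.app i x) = g.app i x := by
  change g.app i (hp i (p.app i x)).choose = _
  rw [← sub_eq_zero, ← map_sub]
  exact h i _ (by rw [map_sub, (hp i _).choose_spec, sub_self])

theorem mono_of_injective (f : X ⟶ Y) (hf : ∀ i, Function.Injective (f.app i)) : Mono f where
  right_cancellation g h e := by
    ext i x
    exact hf i (congrArg (fun q : _ ⟶ Y => q.app i x) e)

theorem epi_of_surjective (f : X ⟶ Y) (hf : ∀ i, Function.Surjective (f.app i)) : Epi f where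
  left_cancellation g h e := by
    ext i y
    obtain ⟨x, rfl⟩ := hf i y
    exact congrArg (fun q : X ⟶ _ => q.app i x) e

theorem shortExact_of_app (f : X ⟶ Y) (g : Y ⟶ W) (hf : ∀ i, Function.Injective (f.app i))
    (hg : ∀ i, Function.Surjective (g.app i)) (w : f ≫ g = 0)
    (h : ∀ i y, g.app i y = 0 → ∃ x, f.app i x = y) : (ShortComplex.mk f g w).ShortExact := by
  have := mono_of_injective f hf
  have := epi_of_surjective g hg
  refine .mk' (ShortComplex.exact_of_f_is_kernel _ (KernelFork.IsLimit.ofι _ _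
    (fun {Z} t ht => liftOfInjective f hf t fun i x =>
      h i _ (congrArg (fun q : Z ⟶ W => q.app i x) ht)) (fun t ht => ?_) (fun t ht m hm => ?_)))
    inferInstance inferInstance
  · ext i x
    exact liftOfInjective_spec f hf t _ i x
  · rw [← cancel_mono f]
    refine hm.trans ?_
    ext i x
    exact (liftOfInjective_spec f hf t _ i x).symm

theorem cokerπ_app_eq_zero (f : M ⟶ N) {i : ℤ} (x : N.obj i) :
    (cokerπ f).app i x = 0 ↔ ∃ y, f.app i y = x :=
  QuotientAddGroup.eq_zero_iff _

theorem cokerπ_surjective (f : M ⟶ N) (i : ℤ) : Function.Surjective ((cokerπ f).app i) :=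
  QuotientAddGroup.mk_surjective

/-! ### Shifts -/

/-- The suspension of a morphism. -/
def shiftMap (d : ℤ) (f : M ⟶ N) : shift d M ⟶ shift d N :=
  (⟨fun i => f.app (i - d), fun _ a x => hom_act f _ a x⟩ : Hom (shift d M) (shift d N))

/-- The short complex `Σ^d X ⟶ Σ^d Y ⟶ Σ^d (Y / X)` given by a morphism `X ⟶ Y`. -/
abbrev shiftCokerComplex (f : X ⟶ Y) (d : ℤ) : ShortComplex (GrMod.{u, v} 𝒜) :=
  ShortComplex.mk (shiftMap d f) (shiftMap d (cokerπ f)) (by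
    ext i x
    exact (cokerπ_app_eq_zero f _).2 ⟨x, rfl⟩)

theorem shortExact_shift_coker (f : X ⟶ Y) (hf : ∀ i, Function.Injective (f.app i)) (d : ℤ) :
    (shiftCokerComplex f d).ShortExact :=
  shortExact_of_app _ _ (fun i => hf (i - d)) (fun i => cokerπ_surjective f (i - d)) _
    (fun i y hy => (cokerπ_app_eq_zero f (i := i - d) y).1 hy)

/-- Multiplication by `1`, which identifies `M` and `Σ^c Σ^b M` if `b + c = 0`. -/
def toShiftShift (M : GrMod.{u, v} 𝒜) {b c : ℤ} (h : b + c = 0) : M ⟶ shift c (shift b M) :=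
  (⟨fun i => M.act (show 0 + i = i - c - b by omega) (one 𝒜), fun {i j k} e a x =>
    (M.act_one_act _ _ (show i + j = k - c - b by omega) a x).trans
      (M.act_act_one _ (show i + (j - c - b) = k - c - b by omega) _ a x).symm⟩ : Hom _ _)

/-- Multiplication by `1`, which identifies `Σ^c Σ^b M` and `M` if `b + c = 0`. -/
def ofShiftShift (M : GrMod.{u, v} 𝒜) {b c : ℤ} (h : b + c = 0) : shift c (shift b M) ⟶ M :=
  (⟨fun i => M.act (show 0 + (i - c - b) = i by omega) (one 𝒜), fun {i j k} e a x =>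
    (M.act_one_act (show i + (j - c - b) = k - c - b by omega) _
      (show i + (j - c - b) = k by omega) a x).trans (M.act_act_one _ _ _ a x).symm⟩ :
    Hom (shift c (shift b M)) M)

/-- The identification of `Σ^c Σ^b M` and `Σ^e M` if `b + c = e`, given by multiplication by `1`. -/
def shiftShiftIso (M : GrMod.{u, v} 𝒜) {b c e : ℤ} (h : b + c = e) :
    shift c (shift b M) ≅ shift e M where
  hom := (⟨fun i => M.act (show 0 + (i - c - b) = i - e by omega) (one 𝒜), fun {i j k} e' a x =>
    (M.act_one_act (show i + (j - c - b) = k - c - b by omega) _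
      (show i + (j - c - b) = k - e by omega) a x).trans (M.act_act_one _ _ _ a x).symm⟩ :
    Hom (shift c (shift b M)) (shift e M))
  inv := (⟨fun i => M.act (show 0 + (i - e) = i - c - b by omega) (one 𝒜), fun {i j k} e' a x =>
    (M.act_one_act (show i + (j - e) = k - e by omega) _
      (show i + (j - e) = k - c - b by omega) a x).trans (M.act_act_one _ _ _ a x).symm⟩ :
    Hom (shift e M) (shift c (shift b M)))
  hom_inv_id := by
    ext i x
    exact (M.act_one_act _ _ (zero_add _) _ x).trans (M.act_one _ x)
  inv_hom_id := by
    ext i x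
    exact (M.act_one_act _ _ (zero_add _) _ x).trans (M.act_one _ x)

theorem injective_shift (J : GrMod.{u, v} 𝒜) [Injective J] (d : ℤ) : Injective (shift d J) where
  factors {P Q} g m _ := by
    have := mono_of_injective (shiftMap (-d) m) (fun i => injective_of_mono m _)
    refine ⟨toShiftShift Q (neg_add_cancel d) ≫ shiftMap d (Injective.factorThru
      (shiftMap (-d) g ≫ ofShiftShift J (add_neg_cancel d)) (shiftMap (-d) m)), ?_⟩
    ext i x
    have h := congrArg (fun q : _ ⟶ J => q.app (i - d)
      ((toShiftShift P (neg_add_cancel d)).app i x)) (Injective.comp_factorThru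
      (shiftMap (-d) g ≫ ofShiftShift J (add_neg_cancel d)) (shiftMap (-d) m))
    refine Eq.trans (congrArg (Hom.app _ (i - d)) (hom_act m _ (one 𝒜) x).symm) (h.trans ?_)
    have h' := hom_act g (show 0 + i = i - d - -d by omega) (one 𝒜) x
    refine (congrArg (J.act (show 0 + (i - d - -d - d) = i - d by omega) (one 𝒜)) h').trans ?_
    exact (J.act_act_one (show 0 + (i - d) = i - d - -d - d by omega) _ (zero_add _) _ _).trans
      (J.act_one _ _)

end

/-! ### Enough injectives -/

/-- The graded module coinduced from a family `D` of abelian groups: in degree `i` it consists of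
the families of additive maps `𝒜 l → D j`, one for each pair `(l, j)` with `l + i = j`. -/
def coinduced (𝒜 : ℤ → AddSubgroup A) [GradedRing 𝒜] (D : ℤ → Type u) [∀ i, AddCommGroup (D i)] :
    GrMod.{u, u} 𝒜 where
  obj i := ∀ p : {p : ℤ × ℤ // p.1 + i = p.2}, 𝒜 p.1.1 →+ D p.1.2
  act {e i k} h := AddMonoidHom.mk' (fun a => AddMonoidHom.mk'
      (fun φ p => AddMonoidHom.mk'
        (fun c => φ ⟨(p.1.1 + e, p.1.2), by have := p.2; dsimp only; omega⟩
          ⟨(c : A) * a, SetLike.GradedMul.mul_mem c.2 a.2⟩)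
        (fun c c' => by
          rw [← map_add]
          exact congrArg _ (Subtype.ext (add_mul _ _ _))))
      (fun φ ψ => rfl))
    (fun a b => by
      refine AddMonoidHom.ext fun φ => funext fun p => AddMonoidHom.ext fun c => ?_
      refine Eq.trans ?_ (map_add (φ ⟨(p.1.1 + e, p.1.2), by have := p.2; dsimp only; omega⟩)
        ⟨(c : A) * a, SetLike.GradedMul.mul_mem c.2 a.2⟩
        ⟨(c : A) * b, SetLike.GradedMul.mul_mem c.2 b.2⟩)
      exact congrArg (φ _) (Subtype.ext (mul_add _ _ _)))
  one_act {i} h φ := by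
    have key : ∀ (l l' j : ℤ) (hl : l + i = j) (hl' : l' + i = j) (c : 𝒜 l) (c' : 𝒜 l'),
        (c : A) = c' → φ ⟨(l, j), hl⟩ c = φ ⟨(l', j), hl'⟩ c' := by
      intro l l' j hl hl' c c' hc
      obtain rfl : l = l' := by omega
      exact congrArg _ (Subtype.ext hc)
    refine funext fun p => AddMonoidHom.ext fun c => ?_
    exact key _ _ _ _ _ _ _ (by exact mul_one _)
  mul_act {e e' i l p} h₁ h₂ h₃ a b φ := by
    have key : ∀ (l l' j : ℤ) (hl : l + i = j) (hl' : l' + i = j) (c : 𝒜 l) (c' : 𝒜 l'),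
        (c : A) = c' → φ ⟨(l, j), hl⟩ c = φ ⟨(l', j), hl'⟩ c' := by
      intro l l' j hl hl' c c' hc
      obtain rfl : l = l' := by omega
      exact congrArg _ (Subtype.ext hc)
    refine funext fun p => AddMonoidHom.ext fun c => ?_
    exact key _ _ _ _ _ _ _ (by exact (mul_assoc _ _ _).symm)

/-- Additive maps `M.obj j → D j` induce a morphism to the coinduced module. -/
def toCoinduced {D : ℤ → Type u} [∀ i, AddCommGroup (D i)] (M : GrMod.{u, u} 𝒜)
    (q : ∀ j, M.obj j →+ D j) : M ⟶ coinduced 𝒜 D :=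
  (⟨fun i => AddMonoidHom.mk' (fun x p => AddMonoidHom.mk' (fun c => q p.1.2 (M.act p.2 c x))
      (fun c c' => by simp)) (fun x y => funext fun p => AddMonoidHom.ext fun c =>
        (congrArg (q p.1.2) (map_add (M.act p.2 c) x y)).trans (map_add _ _ _)),
    fun {i j k} h a x => funext fun p => AddMonoidHom.ext fun c =>
      congrArg (q p.1.2) (M.act_act _ p.2 c a x)⟩ : Hom M (coinduced 𝒜 D))

theorem injective_coinduced (D : ℤ → Type u) [∀ i, AddCommGroup (D i)]
    [∀ i, Injective (AddCommGrpCat.of (D i))] : Injective (coinduced 𝒜 D) where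
  factors {P Q} g m _ := by
    have hm (j : ℤ) : Mono (AddCommGrpCat.ofHom (m.app j)) :=
      (AddCommGrpCat.mono_iff_injective _).2 (injective_of_mono m j)
    -- A morphism to the coinduced module is determined by its values at `1`.
    let ev (j : ℤ) : P.obj j →+ D j := AddMonoidHom.mk'
      (fun x => g.app j x ⟨(0, j), zero_add j⟩ (one 𝒜)) (fun x y => by rw [map_add]; rfl)
    let q (j : ℤ) : Q.obj j →+ D j :=
      (Injective.factorThru (AddCommGrpCat.ofHom (ev j)) (AddCommGrpCat.ofHom (m.app j))).hom
    have hq (j : ℤ) (x : P.obj j) : q j (m.app j x) = ev j x :=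
      congrArg (fun t : AddCommGrpCat.of (P.obj j) ⟶ AddCommGrpCat.of (D j) => t.hom x)
        (Injective.comp_factorThru (AddCommGrpCat.ofHom (ev j)) (AddCommGrpCat.ofHom (m.app j)))
    refine ⟨toCoinduced Q q, ?_⟩
    ext i x
    refine funext fun ⟨⟨l, j⟩, h⟩ => AddMonoidHom.ext fun (c : 𝒜 l) => ?_
    change l + i = j at h
    change q j (Q.act h c (m.app i x)) = _
    rw [← hom_act, hq]
    change g.app j (P.act h c x) ⟨(0, j), zero_add j⟩ (one 𝒜) = _
    rw [hom_act]
    have key : ∀ (l' : ℤ) (hl' : l' + i = j) (c' : 𝒜 l'),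
        (c' : A) = c → g.app i x ⟨(l', j), hl'⟩ c' = g.app i x ⟨(l, j), h⟩ c := by
      intro l' hl' c' hc
      obtain rfl : l = l' := by omega
      exact congrArg _ (Subtype.ext hc)
    exact key _ _ _ (by exact one_mul _)

theorem exists_injective (M : GrMod.{u, u} 𝒜) : ∃ (I : GrMod.{u, u} 𝒜) (f : M ⟶ I),
    Injective I ∧ ∀ i, Function.Injective (f.app i) := by
  let D (i : ℤ) : AddCommGrpCat.{u} := Injective.under (AddCommGrpCat.of (M.obj i))
  let q (i : ℤ) : M.obj i →+ D i := (Injective.ι (AddCommGrpCat.of (M.obj i))).hom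
  have hq (i : ℤ) : Function.Injective (q i) :=
    (AddCommGrpCat.mono_iff_injective (Injective.ι (AddCommGrpCat.of (M.obj i)))).1 inferInstance
  have (i : ℤ) : Injective (AddCommGrpCat.of (D i)) :=
    inferInstanceAs (Injective (Injective.under (AddCommGrpCat.of (M.obj i))))
  refine ⟨coinduced 𝒜 (fun i => D i), toCoinduced M q, injective_coinduced _,
    fun i x y h => hq i ?_⟩
  have h' : q i (M.act (zero_add i) (one 𝒜) x) = q i (M.act (zero_add i) (one 𝒜) y) :=
    DFunLike.congr_fun (congrFun h ⟨(0, i), zero_add i⟩) (one 𝒜)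
  rwa [act_one, act_one] at h'

/-! ### Graded submodules -/

/-- A graded submodule of a graded module. -/
@[ext]
structure GradedSubmodule (M : GrMod.{u, v} 𝒜) where
  carrier : ∀ i, AddSubgroup (M.obj i)
  act_mem : ∀ {i j k : ℤ} (h : i + j = k) (a : 𝒜 i) {x : M.obj j}, x ∈ carrier j →
    M.act h a x ∈ carrier k

namespace GradedSubmodule

variable {M N : GrMod.{u, v} 𝒜}

instance : PartialOrder (GradedSubmodule M) :=
  PartialOrder.lift GradedSubmodule.carrier fun _ _ => GradedSubmodule.ext

/-- The union of a chain of graded submodules (with `0` added, for the empty chain). -/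
def chainUnion (c : Set (GradedSubmodule M)) (hc : IsChain (· ≤ ·) c) : GradedSubmodule M where
  carrier i :=
    { carrier := {x | x = 0 ∨ ∃ N ∈ c, x ∈ N.carrier i}
      zero_mem' := Or.inl rfl
      add_mem' := by
        rintro x y (rfl | ⟨N, hN, hx⟩) (rfl | ⟨N', hN', hy⟩)
        · exact Or.inl (add_zero 0)
        · exact Or.inr ⟨N', hN', by rwa [zero_add]⟩
        · exact Or.inr ⟨N, hN, by rwa [add_zero]⟩
        · rcases hc.total hN hN' with h | h
          · exact Or.inr ⟨N', hN', add_mem (h i hx) hy⟩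
          · exact Or.inr ⟨N, hN, add_mem hx (h i hy)⟩
      neg_mem' := by
        rintro x (rfl | ⟨N, hN, hx⟩)
        · exact Or.inl neg_zero
        · exact Or.inr ⟨N, hN, neg_mem hx⟩ }
  act_mem h a x := by
    rintro (rfl | ⟨N, hN, hx⟩)
    · exact Or.inl (map_zero _)
    · exact Or.inr ⟨N, hN, N.act_mem h a hx⟩

/-- The graded submodule generated by `N` and a homogeneous element `z`. -/
def adjoin (N : GradedSubmodule M) {j : ℤ} (z : M.obj j) : GradedSubmodule M where
  carrier k :=
    { carrier := {w | ∃ (a : 𝒜 (k - j)), ∃ x ∈ N.carrier k,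
        w = x + M.act (sub_add_cancel k j) a z}
      zero_mem' := ⟨0, 0, zero_mem _, by simp⟩
      add_mem' := by
        rintro _ _ ⟨a, x, hx, rfl⟩ ⟨b, y, hy, rfl⟩
        exact ⟨a + b, x + y, add_mem hx hy, by simp only [map_add, AddMonoidHom.add_apply]; abel⟩
      neg_mem' := by
        rintro _ ⟨a, x, hx, rfl⟩
        exact ⟨-a, -x, neg_mem hx, by simp only [map_neg, AddMonoidHom.neg_apply]; abel⟩ }
  act_mem {i k l} h b w := by
    rintro ⟨a, x, hx, rfl⟩
    refine ⟨⟨(b : A) * a, ?_⟩, _, N.act_mem h b hx, ?_⟩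
    · rw [show l - j = i + (k - j) by omega]
      exact SetLike.GradedMul.mul_mem b.2 a.2
    · rw [map_add, act_act]
      exact congrArg _ (M.act_congr _ _ (by rfl) z)

theorem le_adjoin (N : GradedSubmodule M) {j : ℤ} (z : M.obj j) : N ≤ N.adjoin z :=
  fun _ x hx => ⟨0, x, hx, by simp⟩

theorem mem_adjoin_self (N : GradedSubmodule M) {j : ℤ} (z : M.obj j) :
    z ∈ (N.adjoin z).carrier j := by
  refine ⟨⟨1, ?_⟩, 0, zero_mem _, ?_⟩
  · rw [sub_self]
    exact SetLike.GradedOne.one_mem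
  · rw [zero_add]
    exact (M.act_one (zero_add j) z).symm.trans (M.act_congr _ _ (by rfl) z)

/-- The zero submodule. -/
instance : Bot (GradedSubmodule M) :=
  ⟨⟨fun _ => ⊥, fun h a x hx => by
    rw [AddSubgroup.mem_bot] at hx ⊢
    rw [hx, map_zero]⟩⟩

theorem mem_bot {j : ℤ} {x : M.obj j} : x ∈ (⊥ : GradedSubmodule M).carrier j ↔ x = 0 :=
  AddSubgroup.mem_bot

/-- Let `P` be a property of homogeneous elements, satisfied by `0`. Among the graded submodules
all of whose elements satisfy `P` there is a maximal one. -/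
theorem exists_maximal (P : ∀ i, M.obj i → Prop) (h0 : ∀ i, P i 0) :
    ∃ N : GradedSubmodule M, (∀ i, ∀ x ∈ N.carrier i, P i x) ∧
      ∀ (j : ℤ) (z : M.obj j), z ∉ N.carrier j →
        ∃ (e k : ℤ) (h : e + j = k) (a : 𝒜 e), ∃ x ∈ N.carrier k, ¬ P k (x + M.act h a z) := by
  obtain ⟨N, hN⟩ := zorn_le₀ {N : GradedSubmodule M | ∀ i, ∀ x ∈ N.carrier i, P i x}
    (fun c hcs hc => by
      refine ⟨chainUnion c hc, ?_, fun N hN i x hx => Or.inr ⟨N, hN, hx⟩⟩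
      rintro i x (rfl | ⟨N, hN, hx⟩)
      · exact h0 i
      · exact hcs hN i x hx)
  refine ⟨N, hN.prop, fun j z hz => ?_⟩
  by_contra! H
  refine hz (hN.le_of_ge (y := N.adjoin z) ?_ (N.le_adjoin z) j (N.mem_adjoin_self z))
  rintro k _ ⟨a, x, hx, rfl⟩
  exact H _ _ _ a x hx

/-- A graded submodule as a graded module. -/
def toGrMod (N : GradedSubmodule M) : GrMod.{u, v} 𝒜 where
  obj i := N.carrier i
  act {i j k} h := AddMonoidHom.mk' (fun a => AddMonoidHom.mk'
      (fun x => ⟨M.act h a x, N.act_mem h a x.2⟩)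
      (fun x y => by ext; simp)) (fun a b => by ext x; simp)
  one_act h x := Subtype.ext (M.one_act h x.1)
  mul_act h₁ h₂ h₃ a b x := Subtype.ext (M.mul_act h₁ h₂ h₃ a b x.1)

/-- The inclusion of a graded submodule. -/
def incl (N : GradedSubmodule M) : N.toGrMod ⟶ M :=
  (⟨fun i => (N.carrier i).subtype, fun _ _ _ => rfl⟩ : Hom N.toGrMod M)

theorem incl_injective (N : GradedSubmodule M) (i : ℤ) : Function.Injective (N.incl.app i) :=
  Subtype.val_injective

theorem cokerπ_incl_eq_zero (N : GradedSubmodule M) {i : ℤ} (x : M.obj i) :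
    (cokerπ N.incl).app i x = 0 ↔ x ∈ N.carrier i := by
  rw [cokerπ_app_eq_zero]
  exact ⟨fun ⟨y, hy⟩ => hy ▸ y.2, fun hx => ⟨⟨x, hx⟩, rfl⟩⟩

end GradedSubmodule

/-! ### Injective hulls -/

/-- Every graded module `X` embeds into an injective one as an essential submodule. Inside any
injective `I ⊇ X`, let `K` be maximal with `K ∩ X = 0`. Then `I ⧸ K` is essential over `X`, and it
is injective because `K` is a direct summand of `I`: if `L` is maximal with `L ∩ K = 0`, the
inclusion of `K` extends to a morphism `I ⧸ L ⟶ I`, whose image is `K` by maximality. -/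
theorem exists_injective_essential (X : GrMod.{u, u} 𝒜) :
    ∃ (J : GrMod.{u, u} 𝒜) (f : X ⟶ J), Injective J ∧ (∀ i, Function.Injective (f.app i)) ∧
      ∀ (j : ℤ) (z : J.obj j), z ≠ 0 → ∃ (e k : ℤ) (h : e + j = k) (a : 𝒜 e) (x : X.obj k),
        f.app k x = J.act h a z ∧ J.act h a z ≠ 0 := by
  obtain ⟨I, i₀, _, hi⟩ := exists_injective X
  obtain ⟨K, hK, hKmax⟩ := GradedSubmodule.exists_maximal (M := I)
    (fun i x => (∃ y, i₀.app i y = x) → x = 0) (fun i _ => rfl)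
  obtain ⟨L, hL, hLmax⟩ := GradedSubmodule.exists_maximal (M := I)
    (fun i x => x ∈ K.carrier i → x = 0) (fun i _ => rfl)
  let π := cokerπ K.incl
  let q := cokerπ L.incl
  have hq (i : ℤ) (x : I.obj i) : q.app i x = 0 ↔ x ∈ L.carrier i := L.cokerπ_incl_eq_zero x
  have hπ (i : ℤ) (x : I.obj i) : π.app i x = 0 ↔ x ∈ K.carrier i := K.cokerπ_incl_eq_zero x
  have : Mono (K.incl ≫ q) := mono_of_injective _ fun i => by
    rw [injective_iff_map_eq_zero]
    intro x hx
    exact Subtype.ext (hL i x.1 ((hq i _).1 hx) x.2)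
  let φ : coker L.incl ⟶ I := Injective.factorThru K.incl (K.incl ≫ q)
  have hφ (i : ℤ) (x : I.obj i) (hx : x ∈ K.carrier i) : φ.app i (q.app i x) = x :=
    congrArg (fun t : K.toGrMod ⟶ I => t.app i ⟨x, hx⟩)
      (Injective.comp_factorThru K.incl (K.incl ≫ q))
  -- The image of `φ` contains `K` and meets `X` trivially, since a nonzero common element would have
  -- a nonzero multiple in `K ∩ X`. As `K` is maximal with this property, the image is `K`.
  have hφK (i : ℤ) (w : I.obj i) : φ.app i (q.app i w) ∈ K.carrier i := by
    by_contra hz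
    obtain ⟨e, k, h, a, x, hx, hP⟩ := hKmax i _ hz
    push Not at hP
    obtain ⟨⟨y, hy⟩, hne⟩ := hP
    have hv : φ.app k (q.app k (x + I.act h a w)) = x + I.act h a (φ.app i (q.app i w)) := by
      rw [map_add, map_add, hφ k x hx, hom_act, hom_act]
    have hvL : x + I.act h a w ∉ L.carrier k := fun hmem => by
      rw [(hq k _).2 hmem, map_zero] at hv
      exact hne hv.symm
    obtain ⟨e', l, h', b, y', hy', hP'⟩ := hLmax k _ hvL
    push Not at hP'
    obtain ⟨hmemK, hne'⟩ := hP'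
    apply hne'
    have hval := hφ l _ hmemK
    rw [map_add, (hq l y').2 hy', zero_add, hom_act, hom_act, hv, ← hy] at hval
    refine hK l _ hmemK ⟨X.act h' b y, ?_⟩
    rw [hom_act, hval]
  have hrange (i : ℤ) (w : I.obj i) : ∃ y, K.incl.app i y = (q ≫ φ).app i w :=
    ⟨(⟨_, hφK i w⟩ : K.carrier i), rfl⟩
  let r : I ⟶ K.toGrMod := liftOfInjective K.incl K.incl_injective (q ≫ φ) hrange
  have hr : K.incl ≫ r = 𝟙 _ := by
    ext i x
    apply K.incl_injective i
    exact (liftOfInjective_spec K.incl K.incl_injective (q ≫ φ) hrange i _).trans (hφ i x.1 x.2)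
  -- As `K` is a retract of `I` via `r`, the quotient `I ⧸ K` is a retract of `I` via `s`.
  let s : coker K.incl ⟶ I := cokerDesc K.incl (𝟙 I - r ≫ K.incl) (by
    rw [Preadditive.comp_sub, ← Category.assoc, hr, Category.comp_id, Category.id_comp, sub_self])
  have hs : s ≫ π = 𝟙 _ := by
    ext i x
    obtain ⟨x, rfl⟩ := cokerπ_surjective K.incl i x
    change π.app i (x - K.incl.app i (r.app i x)) = π.app i x
    rw [map_sub, (hπ i (K.incl.app i (r.app i x))).2 (r.app i x).2, sub_zero]
  refine ⟨coker K.incl, i₀ ≫ π, Retract.injective ⟨s, π, hs⟩, fun i => ?_, fun j z hz => ?_⟩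
  · rw [injective_iff_map_eq_zero]
    intro x hx
    apply hi i
    rw [map_zero]
    exact hK i _ ((hπ i _).1 hx) ⟨x, rfl⟩
  · obtain ⟨z, rfl⟩ := cokerπ_surjective K.incl j z
    obtain ⟨e, k, h, a, n, hn, hP⟩ := hKmax j z (fun hmem => hz ((hπ j z).2 hmem))
    push Not at hP
    obtain ⟨⟨x, hx⟩, hne⟩ := hP
    have hx' : π.app k (i₀.app k x) = (coker K.incl).act h a (π.app j z) := by
      rw [hx, map_add, (hπ k n).2 hn, zero_add, hom_act]
    refine ⟨e, k, h, a, x, hx', fun h0 => hne ?_⟩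
    rw [← hx]
    exact hK k _ ((hπ k _).1 (hx'.trans h0)) ⟨x, rfl⟩

/-! ### Torsion elements and the socle -/

section Socle

variable {M N X Y : GrMod.{u, v} 𝒜} (𝔪 : HomogeneousIdeal 𝒜)

/-- A homogeneous element lies in the socle if it is annihilated by `𝔪`. -/
def InSocle (X : GrMod.{u, v} 𝒜) {j : ℤ} (y : X.obj j) : Prop :=
  ∀ {i k : ℤ} (h : i + j = k) (a : 𝒜 i), (a : A) ∈ 𝔪.toIdeal → X.act h a y = 0

/-- The socle of `X` is zero. -/
def SocleFree (X : GrMod.{u, v} 𝒜) : Prop := ∀ (j : ℤ) (y : X.obj j), InSocle 𝔪 X y → y = 0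

/-- A homogeneous element is torsion if it is annihilated by some power of `𝔪`. -/
def IsTorsionElement (X : GrMod.{u, v} 𝒜) {j : ℤ} (x : X.obj j) : Prop :=
  ∃ s : ℕ, ∀ {i k : ℤ} (h : i + j = k) (a : 𝒜 i), (a : A) ∈ 𝔪.toIdeal ^ s → X.act h a x = 0

variable {𝔪}

theorem InSocle.isTorsionElement {j : ℤ} {y : X.obj j} (hy : InSocle 𝔪 X y) :
    IsTorsionElement 𝔪 X y :=
  ⟨1, fun h a ha => hy h a (by rwa [pow_one] at ha)⟩

theorem IsTorsionElement.add {j : ℤ} {x y : X.obj j} (hx : IsTorsionElement 𝔪 X x)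
    (hy : IsTorsionElement 𝔪 X y) : IsTorsionElement 𝔪 X (x + y) := by
  obtain ⟨s, hs⟩ := hx
  obtain ⟨t, ht⟩ := hy
  refine ⟨max s t, fun h a ha => ?_⟩
  rw [map_add, hs h a (Ideal.pow_le_pow_right (le_max_left s t) ha),
    ht h a (Ideal.pow_le_pow_right (le_max_right s t) ha), add_zero]

theorem IsTorsionElement.neg {j : ℤ} {x : X.obj j} (hx : IsTorsionElement 𝔪 X x) :
    IsTorsionElement 𝔪 X (-x) := by
  obtain ⟨s, hs⟩ := hx
  exact ⟨s, fun h a ha => by rw [map_neg, hs h a ha, neg_zero]⟩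

theorem IsTorsionElement.act {j : ℤ} {x : X.obj j} (hx : IsTorsionElement 𝔪 X x) {e k : ℤ}
    (h : e + j = k) (b : 𝒜 e) : IsTorsionElement 𝔪 X (X.act h b x) := by
  obtain ⟨s, hs⟩ := hx
  exact ⟨s, fun h' a ha => by rw [act_act]; exact hs _ _ (Ideal.mul_mem_right _ _ ha)⟩

theorem IsTorsionElement.map (f : X ⟶ Y) {j : ℤ} {x : X.obj j} (hx : IsTorsionElement 𝔪 X x) :
    IsTorsionElement 𝔪 Y (f.app j x) := by
  obtain ⟨s, hs⟩ := hx
  exact ⟨s, fun h a ha => by rw [← hom_act, hs h a ha, map_zero]⟩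

/-- If a torsion element `x` does not lie in `N`, then some homogeneous multiple of `x` represents
a nonzero socle element of `M ⧸ N`. -/
theorem IsTorsionElement.exists_act_notMem (N : GradedSubmodule M) {j : ℤ} {x : M.obj j}
    (hx : IsTorsionElement 𝔪 M x) (hN : x ∉ N.carrier j) :
    ∃ (e k : ℤ) (h : e + j = k) (a : 𝒜 e), M.act h a x ∉ N.carrier k ∧
      ∀ {i l : ℤ} (h' : i + k = l) (c : 𝒜 i), (c : A) ∈ 𝔪.toIdeal →
        M.act h' c (M.act h a x) ∈ N.carrier l := by
  obtain ⟨s, hs⟩ := hx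
  replace hs : ∀ {i k : ℤ} (h : i + j = k) (a : 𝒜 i), (a : A) ∈ 𝔪.toIdeal ^ s →
      M.act h a x ∈ N.carrier k := fun h a ha => by
    rw [hs h a ha]
    exact zero_mem _
  induction s with
  | zero =>
    refine absurd (hs (zero_add j) (one 𝒜) ?_) ?_
    · simp
    · rwa [act_one]
  | succ s ih =>
    by_cases H : ∀ {i k : ℤ} (h : i + j = k) (a : 𝒜 i), (a : A) ∈ 𝔪.toIdeal ^ s →
        M.act h a x ∈ N.carrier k
    · exact ih H
    · push Not at H
      obtain ⟨e, k, h, a, ha, hne⟩ := H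
      refine ⟨e, k, h, a, hne, fun h' c hc => ?_⟩
      rw [act_act]
      refine hs _ _ ?_
      rw [pow_succ']
      exact Ideal.mul_mem_mul hc ha

theorem IsTorsionElement.exists_inSocle {j : ℤ} {x : M.obj j} (hx : IsTorsionElement 𝔪 M x)
    (h0 : x ≠ 0) : ∃ (e k : ℤ) (h : e + j = k) (a : 𝒜 e), M.act h a x ≠ 0 ∧
      InSocle 𝔪 M (M.act h a x) := by
  obtain ⟨e, k, h, a, hne, H⟩ := hx.exists_act_notMem ⊥
    (fun hx0 => h0 (GradedSubmodule.mem_bot.1 hx0))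
  exact ⟨e, k, h, a, fun h' => hne (GradedSubmodule.mem_bot.2 h'),
    fun h' c hc => GradedSubmodule.mem_bot.1 (H h' c hc)⟩

theorem SocleFree.eq_zero (hX : SocleFree 𝔪 X) {j : ℤ} {x : X.obj j}
    (hx : IsTorsionElement 𝔪 X x) : x = 0 := by
  by_contra h0
  obtain ⟨e, k, h, a, hne, hs⟩ := hx.exists_inSocle h0
  exact hne (hX k _ hs)

theorem SocleFree.hom_eq_zero (hX : SocleFree 𝔪 X) (hM : M.IsTorsion 𝔪) (d : ℤ)
    (f : M ⟶ shift d X) : f = 0 := by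
  ext i x
  obtain ⟨s, hs⟩ := hM i x
  refine hX.eq_zero (x := (f.app i x : X.obj (i - d))) ⟨s, fun {i' k} h a ha => ?_⟩
  obtain ⟨k, rfl⟩ : ∃ l, k = l - d := ⟨k + d, by omega⟩
  exact (hom_act f (show i' + i = k by omega) a x).symm.trans
    ((congrArg (f.app k) (hs _ a ha)).trans (map_zero (f.app k)))

end Socle

/-! ### The residue field -/

variable (𝔪 : HomogeneousIdeal 𝒜)

/-- The projection of the ring to its residue field. -/
def residueMap : self 𝒜 ⟶ quotient 𝔪 :=
  (⟨fun i => AddMonoidHom.mk' (fun a : 𝒜 i => ⟨Ideal.Quotient.mk 𝔪.toIdeal a, a, a.2, rfl⟩)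
      (fun _ _ => Subtype.ext (map_add _ _ _)),
    fun _ _ _ => Subtype.ext (map_mul (Ideal.Quotient.mk 𝔪.toIdeal) _ _)⟩ :
    Hom (self 𝒜) (quotient 𝔪))

theorem residueMap_surjective (i : ℤ) : Function.Surjective ((residueMap 𝔪).app i) := by
  rintro ⟨_, a, ha, rfl⟩
  exact ⟨⟨a, ha⟩, rfl⟩

theorem residueMap_eq_zero {i : ℤ} (a : 𝒜 i) :
    (residueMap 𝔪).app i a = 0 ↔ (a : A) ∈ 𝔪.toIdeal :=
  Subtype.ext_iff.trans Ideal.Quotient.eq_zero_iff_mem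

/-- The element `1` of the residue field. -/
def residueOne : (quotient 𝔪).obj 0 := (residueMap 𝔪).app 0 (one 𝒜)

theorem residueMap_eq_act {i : ℤ} (a : 𝒜 i) :
    (residueMap 𝔪).app i a = (quotient 𝔪).act (add_zero i) a (residueOne 𝔪) :=
  (congrArg ((residueMap 𝔪).app i) (Subtype.ext (mul_one (a : A)).symm)).trans
    (hom_act (residueMap 𝔪) (add_zero i) a (one 𝒜))

theorem inSocle_quotient {j : ℤ} (x : (quotient 𝔪).obj j) : InSocle 𝔪 (quotient 𝔪) x := by
  obtain ⟨b, rfl⟩ := residueMap_surjective 𝔪 j x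
  intro i k h a ha
  rw [← hom_act]
  exact (residueMap_eq_zero 𝔪 _).2 (Ideal.mul_mem_right _ _ ha)

theorem residue_shortExact :
    (ShortComplex.mk (kerι (residueMap 𝔪)) (residueMap 𝔪) (kerι_comp _)).ShortExact :=
  shortExact_of_app _ _ (fun _ => Subtype.val_injective) (residueMap_surjective 𝔪) _
    (fun _ y hy => ⟨⟨y, hy⟩, rfl⟩)

variable {𝔪}

/-- A socle element `y` of degree `j` is the image of `1` under a morphism `k ⟶ Σ^{-j} X`. -/
theorem InSocle.exists_hom {X : GrMod.{u, u} 𝒜} {j : ℤ} {y : X.obj j} (hy : InSocle 𝔪 X y) :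
    ∃ φ : quotient 𝔪 ⟶ shift (-j) X, ∀ (i : ℤ) (a : 𝒜 i),
      φ.app i ((residueMap 𝔪).app i a) = X.act (show i + j = i - -j by omega) a y := by
  let g : self 𝒜 ⟶ shift (-j) X :=
    (⟨fun i => AddMonoidHom.mk' (fun a : 𝒜 i => X.act (show i + j = i - -j by omega) a y)
        (fun a b => DFunLike.congr_fun
          (map_add (X.act (show i + j = i - -j by omega)) (a : 𝒜 i) b) y),
      fun {i l k} h a x => (X.act_congr _ _ (by rfl) y).trans (X.act_act
        (show l + j = l - -j by omega) (show i + (l - -j) = k - -j by omega) a x y).symm⟩ :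
      Hom (self 𝒜) (shift (-j) X))
  exact ⟨descOfSurjective (residueMap 𝔪) (residueMap_surjective 𝔪) g
    fun i x hx => hy _ _ ((residueMap_eq_zero 𝔪 x).1 hx), fun i a =>
    descOfSurjective_app (residueMap 𝔪) (residueMap_surjective 𝔪) g _ i a⟩

theorem socleFree_of_hom {X : GrMod.{u, u} 𝒜}
    (h : ∀ (d : ℤ) (φ : quotient 𝔪 ⟶ shift (-d) X), φ = 0) : SocleFree 𝔪 X := by
  intro j y hy
  obtain ⟨φ, hφ⟩ := hy.exists_hom
  apply X.act_one_injective (show 0 + j = 0 - -j by omega)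
  rw [map_zero]
  refine (hφ 0 (one 𝒜)).symm.trans ?_
  rw [h j φ]
  rfl

/-- In the graded field `A ⧸ 𝔪`, nonzero homogeneous elements are invertible. -/
theorem exists_mul_add_eq_one (h𝔪 : IsCoatom 𝔪) {i : ℤ} (a : 𝒜 i) (ha : (a : A) ∉ 𝔪.toIdeal) :
    ∃ (b : 𝒜 (-i)) (c : 𝒜 0), (c : A) ∈ 𝔪.toIdeal ∧ (c : A) + b * a = 1 := by
  let J : HomogeneousIdeal 𝒜 := ⟨Ideal.span {(a : A)}, Ideal.homogeneous_span 𝒜 _ (by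
    rintro _ rfl
    exact ⟨i, a.2⟩)⟩
  have hJ : (a : A) ∈ J.toIdeal := Ideal.subset_span rfl
  have hlt : 𝔪 < 𝔪 ⊔ J := by
    refine lt_of_le_of_ne le_sup_left fun h => ha ?_
    have : J ≤ 𝔪 := by rw [h]; exact le_sup_right
    exact this hJ
  have htop : (1 : A) ∈ (𝔪 ⊔ J).toIdeal := by
    rw [h𝔪.2 _ hlt]
    exact Submodule.mem_top
  rw [HomogeneousIdeal.toIdeal_sup] at htop
  obtain ⟨c, hc, r, hr, hcr⟩ := Submodule.mem_sup.1 htop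
  obtain ⟨b, rfl⟩ := Ideal.mem_span_singleton'.1 hr
  refine ⟨DirectSum.decompose 𝒜 b (-i), DirectSum.decompose 𝒜 c 0, 𝔪.isHomogeneous 0 hc, ?_⟩
  rw [← DirectSum.coe_decompose_mul_add_of_right_mem 𝒜 a.2, neg_add_cancel, ← AddSubgroup.coe_add,
    ← DirectSum.add_apply, ← DirectSum.decompose_add, hcr,
    DirectSum.decompose_of_mem_same 𝒜 SetLike.GradedOne.one_mem]

/-! ### From the residue field to torsion modules -/

/-- The direct sum of two graded modules. -/
def prod (M N : GrMod.{u, v} 𝒜) : GrMod.{u, v} 𝒜 where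
  obj i := M.obj i × N.obj i
  act h := AddMonoidHom.mk' (fun a => AddMonoidHom.prodMap (M.act h a) (N.act h a))
    (fun a b => AddMonoidHom.ext fun x => Prod.ext (by simp) (by simp))
  one_act h x := Prod.ext (M.one_act h x.1) (N.one_act h x.2)
  mul_act h₁ h₂ h₃ a b x := Prod.ext (M.mul_act h₁ h₂ h₃ a b x.1) (N.mul_act h₁ h₂ h₃ a b x.2)

/-- The first projection. -/
def fst (M N : GrMod.{u, v} 𝒜) : prod M N ⟶ M :=
  (⟨fun _ => AddMonoidHom.fst _ _, fun _ _ _ => rfl⟩ : Hom (prod M N) M)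

/-- The second projection. -/
def snd (M N : GrMod.{u, v} 𝒜) : prod M N ⟶ N :=
  (⟨fun _ => AddMonoidHom.snd _ _, fun _ _ _ => rfl⟩ : Hom (prod M N) N)

/-- Let `0 ⟶ Y ⟶ I ⟶ Z ⟶ 0` be exact and suppose that all morphisms `𝔪 ⟶ Σ^{-d} Y` extend
to the ring. Then every morphism from a torsion module to `Z` lifts to `I`. Partial lifts are
encoded by their graphs, and a maximal one is total: otherwise the quotient by its domain has a
socle element, and the hypothesis extends the lift to that element. -/
theorem exists_lift_of_extends (h𝔪 : IsCoatom 𝔪) {Y I Z M : GrMod.{u, u} 𝒜} (i : Y ⟶ I)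
    (p : I ⟶ Z) (hi : ∀ j, Function.Injective (i.app j)) (hp : ∀ j, Function.Surjective (p.app j))
    (hip : ∀ j x, p.app j (i.app j x) = 0) (hpi : ∀ j e, p.app j e = 0 → ∃ y, i.app j y = e)
    (H : ∀ (d : ℤ) (g : ker (residueMap 𝔪) ⟶ shift (-d) Y),
      ∃ f : self 𝒜 ⟶ shift (-d) Y, kerι (residueMap 𝔪) ≫ f = g)
    (hM : M.IsTorsion 𝔪) (g : M ⟶ Z) : ∃ h : M ⟶ I, h ≫ p = g := by
  obtain ⟨Γ, hΓ, hmax⟩ := GradedSubmodule.exists_maximal (M := prod M I)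
    (fun j x => p.app j x.2 = g.app j x.1 ∧ (x.1 = 0 → x.2 = 0))
    (fun j => ⟨(map_zero (p.app j)).trans (map_zero (g.app j)).symm, fun _ => rfl⟩)
  have huniq {j : ℤ} {x : M.obj j} {e e' : I.obj j} (h : (x, e) ∈ Γ.carrier j)
      (h' : (x, e') ∈ Γ.carrier j) : e = e' :=
    sub_eq_zero.1 ((hΓ j _ (sub_mem h h')).2 (sub_self x))
  let N : GradedSubmodule M :=
    { carrier := fun j => (Γ.carrier j).map (AddMonoidHom.fst (M.obj j) (I.obj j))
      act_mem := by
        rintro j k l h a _ ⟨x, hx, rfl⟩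
        exact ⟨_, Γ.act_mem h a hx, rfl⟩ }
  have hN {j : ℤ} (x : M.obj j) : x ∈ N.carrier j ↔ ∃ e, (x, e) ∈ Γ.carrier j :=
    ⟨fun ⟨⟨_, e⟩, h, hx⟩ => ⟨e, hx ▸ h⟩, fun ⟨e, h⟩ => ⟨_, h, rfl⟩⟩
  have htotal (j : ℤ) (x : M.obj j) : ∃ e, (x, e) ∈ Γ.carrier j := by
    by_contra hx₀
    obtain ⟨j, x, hx, hsoc⟩ : ∃ (j : ℤ) (x : M.obj j), x ∉ N.carrier j ∧
        ∀ {t l : ℤ} (h : t + j = l) (c : 𝒜 t), (c : A) ∈ 𝔪.toIdeal →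
          ∃ e, (M.act h c x, e) ∈ Γ.carrier l := by
      obtain ⟨_, j', h, a, hx', hsoc⟩ :=
        IsTorsionElement.exists_act_notMem (𝔪 := 𝔪) N (hM j x) (fun h => hx₀ ((hN x).1 h))
      exact ⟨j', _, hx', fun h c hc => (hN _).1 (hsoc h c hc)⟩
    obtain ⟨e, he⟩ := hp j (g.app j x)
    -- On `𝔪 x`, the partial lift differs from `c x ↦ c e` by a morphism `ψ` with values in `Y`.
    let v (t : ℤ) : (ker (residueMap 𝔪)).obj t →+ 𝒜 t := (kerι (residueMap 𝔪)).app t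
    have hmem (t : ℤ) (c : (ker (residueMap 𝔪)).obj t) : (v t c : A) ∈ 𝔪.toIdeal :=
      (residueMap_eq_zero 𝔪 _).1 c.2
    have hv {s t l : ℤ} (h : s + t = l) (a : 𝒜 s) (c : (ker (residueMap 𝔪)).obj t) :
        (v l ((ker (residueMap 𝔪)).act h a c) : A) = a * v t c := rfl
    have hlift (t : ℤ) (c : (ker (residueMap 𝔪)).obj t) : ∃ e',
        (M.act (show t + j = t - -j by omega) (v t c) x, e') ∈ Γ.carrier (t - -j) :=
      hsoc _ _ (hmem t c)
    let ψ : ker (residueMap 𝔪) ⟶ shift (-j) I :=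
      (⟨fun t => AddMonoidHom.mk' (fun c => (hlift t c).choose -
            I.act (show t + j = t - -j by omega) (v t c) e) (fun c c' => by
          have h₁ := add_mem (hlift t c).choose_spec (hlift t c').choose_spec
          have h₂ : (M.act (show t + j = t - -j by omega) (v t c) x +
              M.act (show t + j = t - -j by omega) (v t c') x, (hlift t (c + c')).choose) ∈
              Γ.carrier (t - -j) := by
            convert (hlift t (c + c')).choose_spec using 2
            rw [map_add, map_add, AddMonoidHom.add_apply]
          have h₃ : I.act (show t + j = t - -j by omega) (v t (c + c')) e =
              I.act (show t + j = t - -j by omega) (v t c) e +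
              I.act (show t + j = t - -j by omega) (v t c') e := by
            rw [map_add, map_add, AddMonoidHom.add_apply]
          rw [huniq h₂ h₁, h₃]
          abel),
        fun {s t l} h a c => by
          have h₁ := Γ.act_mem (show s + (t - -j) = l - -j by omega) a (hlift t c).choose_spec
          have h₂ : (M.act (show s + (t - -j) = l - -j by omega) a
              (M.act (show t + j = t - -j by omega) (v t c) x),
              (hlift l ((ker (residueMap 𝔪)).act h a c)).choose) ∈ Γ.carrier (l - -j) := by
            convert (hlift l ((ker (residueMap 𝔪)).act h a c)).choose_spec using 2
            rw [act_act]
            exact M.act_congr _ _ (hv h a c).symm x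
          have h₃ : I.act (show l + j = l - -j by omega)
                (v l ((ker (residueMap 𝔪)).act h a c)) e =
              I.act (show s + (t - -j) = l - -j by omega) a
                (I.act (show t + j = t - -j by omega) (v t c) e) := by
            rw [act_act]
            exact I.act_congr _ _ (hv h a c) e
          refine Eq.trans ?_ (map_sub (I.act (show s + (t - -j) = l - -j by omega) a) _ _).symm
          exact congrArg₂ (· - ·) (huniq h₂ h₁) h₃⟩ : Hom (ker (residueMap 𝔪)) (shift (-j) I))
    have hψ (t : ℤ) (c : (ker (residueMap 𝔪)).obj t) :
        ∃ y, (shiftMap (-j) i).app t y = ψ.app t c := by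
      refine hpi (t - -j) _ ?_
      refine (map_sub (p.app (t - -j)) _ _).trans (sub_eq_zero.2 ?_)
      refine (hΓ _ _ (hlift t c).choose_spec).1.trans ?_
      change g.app (t - -j) (M.act (show t + j = t - -j by omega) (v t c) x) = _
      rw [hom_act, hom_act, he]
    -- As `ψ` extends to the ring, it is given by multiplication with an element `y` of `Y`, and
    -- `x ↦ e + y` is compatible with the partial lift.
    obtain ⟨f, hf⟩ := H j (liftOfInjective (shiftMap (-j) i) (fun t => hi _) ψ hψ)
    let y : Y.obj j := Y.act (show 0 + (0 - -j) = j by omega) (one 𝒜) (f.app 0 (one 𝒜))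
    have hf' (t : ℤ) (c : 𝒜 t) : f.app t c = Y.act (show t + j = t - -j by omega) c y := by
      have h₁ := hom_act f (add_zero t) c (one 𝒜)
      have h₂ : (self 𝒜).act (add_zero t) c (one 𝒜) = c := Subtype.ext (mul_one (c : A))
      rw [h₂] at h₁
      exact h₁.trans (Y.act_act_one _ _ _ _ _).symm
    have hy {t l : ℤ} (h : t + j = l) (c : 𝒜 t) (hc : (c : A) ∈ 𝔪.toIdeal) :
        (M.act h c x, I.act h c (e + i.app j y)) ∈ Γ.carrier l := by
      obtain rfl : l = t - -j := by omega
      let c' : (ker (residueMap 𝔪)).obj t := ⟨c, (residueMap_eq_zero 𝔪 c).2 hc⟩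
      have h₁ := liftOfInjective_spec (shiftMap (-j) i) (fun t => hi _) ψ hψ t c'
      rw [← hf] at h₁
      have h₂ : i.app (t - -j) (f.app t c) = (hlift t c').choose - I.act h c e := h₁
      rw [hf', hom_act] at h₂
      rw [map_add, h₂, add_sub_cancel]
      exact (hlift t c').choose_spec
    obtain ⟨t, l, h, a, ⟨n, e'⟩, hn, hP⟩ := hmax j (x, e + i.app j y)
      (fun h => hx ((hN x).2 ⟨_, h⟩))
    refine hP ⟨?_, fun h0 => ?_⟩
    · change p.app l (e' + I.act h a (e + i.app j y)) = g.app l (n + M.act h a x)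
      rw [map_add (p.app l), map_add (g.app l), hom_act p, hom_act g, map_add (p.app j), hip,
        add_zero, he]
      exact congrArg (· + _) (hΓ _ _ hn).1
    · change n + M.act h a x = 0 at h0
      have hax : M.act h a x ∈ N.carrier l := by
        rw [← neg_eq_of_add_eq_zero_right h0]
        exact (hN _).2 ⟨_, neg_mem hn⟩
      -- Otherwise `a` would be invertible modulo `𝔪`, so that `x` itself would lie in `N`.
      have ha : (a : A) ∈ 𝔪.toIdeal := by
        by_contra ha
        obtain ⟨b, c, hc, hcb⟩ := exists_mul_add_eq_one h𝔪 a ha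
        apply hx
        have h₁ := add_mem ((hN _).2 (hsoc (zero_add j) c hc))
          (N.act_mem (show -t + l = j by omega) b hax)
        rw [act_act] at h₁
        have h₂ : M.act (show -t + t + j = j by omega)
            ⟨(b : A) * a, SetLike.GradedMul.mul_mem b.2 a.2⟩ x = M.act (zero_add j)
            ⟨(b : A) * a, by simpa using SetLike.GradedMul.mul_mem b.2 a.2⟩ x :=
          M.act_congr _ _ (by rfl) x
        rw [h₂, ← AddMonoidHom.add_apply, ← map_add] at h₁
        convert h₁
        refine (M.act_one (zero_add j) x).symm.trans (M.act_congr _ _ ?_ x)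
        exact hcb.symm
      exact (hΓ _ _ (add_mem hn (hy h a ha))).2 h0
  have hsurj (j : ℤ) : Function.Surjective ((Γ.incl ≫ fst M I).app j) := fun x => by
    obtain ⟨e, he⟩ := htotal j x
    exact ⟨⟨(x, e), he⟩, rfl⟩
  refine ⟨descOfSurjective (Γ.incl ≫ fst M I) hsurj (Γ.incl ≫ snd M I)
    fun j x hx => (hΓ j x.1 x.2).2 hx, ?_⟩
  ext j x
  obtain ⟨z, rfl⟩ := hsurj j x
  exact (congrArg (p.app j) (descOfSurjective_app _ hsurj _ _ j z)).trans (hΓ j z.1 z.2).1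

open Abelian

section LongExactSequence

variable {S : ShortComplex (GrMod.{u, v} 𝒜)} (hS : S.ShortExact)
include hS

theorem exists_extension {Y : GrMod.{u, v} 𝒜} (h : Subsingleton (Ext S.X₃ Y 1)) (g : S.X₁ ⟶ Y) :
    ∃ f : S.X₂ ⟶ Y, S.f ≫ f = g := by
  obtain ⟨x, hx⟩ := Ext.contravariant_sequence_exact₁ hS Y (Ext.mk₀ g) (add_zero 1)
    (Subsingleton.elim _ _)
  obtain ⟨f, rfl⟩ := (Ext.mk₀_bijective _ _).2 x
  exact ⟨f, (Ext.mk₀_bijective _ _).1 (by rw [← hx, Ext.mk₀_comp_mk₀])⟩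

theorem subsingleton_ext_X₁ {W : GrMod.{u, v} 𝒜} {n : ℕ}
    (h₂ : Subsingleton (Ext W S.X₂ (n + 1))) (h₃ : Subsingleton (Ext W S.X₃ n)) :
    Subsingleton (Ext W S.X₁ (n + 1)) := by
  refine subsingleton_of_forall_eq 0 fun x => ?_
  obtain ⟨y, rfl⟩ := Ext.covariant_sequence_exact₁ W hS x (Subsingleton.elim _ _) rfl
  rw [Subsingleton.elim y 0, Ext.zero_comp]

theorem subsingleton_ext_X₃ {W : GrMod.{u, v} 𝒜} {n : ℕ}
    (h₁ : Subsingleton (Ext W S.X₁ (n + 1))) (h₂ : Subsingleton (Ext W S.X₂ n)) :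
    Subsingleton (Ext W S.X₃ n) := by
  refine subsingleton_of_forall_eq 0 fun x => ?_
  obtain ⟨y, rfl⟩ := Ext.covariant_sequence_exact₃ W hS x rfl (Subsingleton.elim _ _)
  rw [Subsingleton.elim y 0, Ext.zero_comp]

theorem bijective_comp_extClass {W : GrMod.{u, v} 𝒜} {n : ℕ}
    (h₂ : Subsingleton (Ext W S.X₂ n)) (h₂' : Subsingleton (Ext W S.X₂ (n + 1))) :
    Function.Bijective (fun x : Ext W S.X₃ n => x.comp hS.extClass rfl) := by
  refine ⟨(injective_iff_map_eq_zero (hS.extClass.postcomp W rfl)).2 fun x hx => ?_, fun x => ?_⟩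
  · obtain ⟨y, rfl⟩ := Ext.covariant_sequence_exact₃ W hS x rfl hx
    rw [Subsingleton.elim y 0, Ext.zero_comp]
  · exact Ext.covariant_sequence_exact₁ W hS x (Subsingleton.elim _ _) rfl

end LongExactSequence

section

variable {M Y : GrMod.{u, u} 𝒜}

theorem SocleFree.subsingleton_ext_zero (hY : SocleFree 𝔪 Y) (hM : M.IsTorsion 𝔪) (d : ℤ) :
    Subsingleton (Ext M (shift d Y) 0) := by
  refine subsingleton_of_forall_eq 0 fun x => ?_
  obtain ⟨f, rfl⟩ := (Ext.mk₀_bijective _ _).2 x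
  rw [hY.hom_eq_zero hM d f, Ext.mk₀_zero]

theorem socleFree_of_subsingleton_ext
    (h : ∀ d, Subsingleton (Ext (quotient 𝔪) (shift (-d) Y) 0)) : SocleFree 𝔪 Y :=
  socleFree_of_hom fun d _ => (Ext.mk₀_bijective _ _).1 ((h d).elim _ _)

theorem subsingleton_ext_one (h𝔪 : IsCoatom 𝔪)
    (hY : ∀ d, Subsingleton (Ext (quotient 𝔪) (shift (-d) Y) 1)) (hM : M.IsTorsion 𝔪) (d : ℤ) :
    Subsingleton (Ext M (shift (-d) Y) 1) := by
  obtain ⟨I, i, _, hi⟩ := exists_injective Y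
  have hS := shortExact_shift_coker i hi (-d)
  refine subsingleton_of_forall_eq 0 fun x => ?_
  have := injective_shift I (-d)
  obtain ⟨x, rfl⟩ := Ext.covariant_sequence_exact₁ M hS x
    (Ext.eq_zero_of_injective (I := shift (-d) I) _) (zero_add 1)
  obtain ⟨g, rfl⟩ := (Ext.mk₀_bijective _ _).2 x
  obtain ⟨h, rfl⟩ := exists_lift_of_extends h𝔪 (shiftMap (-d) i) (shiftMap (-d) (cokerπ i))
    (fun _ => hi _) (fun _ => cokerπ_surjective i _)
    (fun _ x => (cokerπ_app_eq_zero i _).2 ⟨x, rfl⟩)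
    (fun j e he => (cokerπ_app_eq_zero i (i := j - -d) e).1 he) (fun d' g => by
      let e := shiftShiftIso Y (show -d + -d' = -(d + d') by omega)
      obtain ⟨f, hf⟩ := exists_extension (residue_shortExact 𝔪) (hY (d + d')) (g ≫ e.hom)
      refine ⟨f ≫ e.inv, ?_⟩
      rw [← Category.assoc]
      exact (congrArg (· ≫ e.inv) hf).trans (by simp)) hM g
  rw [← Ext.mk₀_comp_mk₀, Ext.comp_assoc_of_second_deg_zero]
  erw [hS.comp_extClass]
  rw [Ext.comp_zero]

/-- If `Ext^i` from all shifts of the residue field to `Y` vanishes, then so does `Ext^i` from any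
torsion module to `Y`. -/
theorem subsingleton_ext_of_isTorsion (h𝔪 : IsCoatom 𝔪) (hM : M.IsTorsion 𝔪) (i : ℕ) :
    ∀ (Y : GrMod.{u, u} 𝒜), (∀ d, Subsingleton (Ext (quotient 𝔪) (shift (-d) Y) i)) →
      ∀ d, Subsingleton (Ext M (shift (-d) Y) i) := by
  match i with
  | 0 => exact fun Y hY d => (socleFree_of_subsingleton_ext hY).subsingleton_ext_zero hM (-d)
  | 1 => exact fun Y hY d => subsingleton_ext_one h𝔪 hY hM d
  | i + 2 =>
    intro Y hY d
    obtain ⟨I, f, _, hf⟩ := exists_injective Y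
    have := injective_shift I
    have hinj (W : GrMod.{u, u} 𝒜) (d : ℤ) (t : ℕ) : Subsingleton (Ext W (shift (-d) I) (t + 1)) :=
      Ext.subsingleton_of_injective ..
    refine subsingleton_ext_X₁ (shortExact_shift_coker f hf (-d)) (hinj _ _ _)
      (subsingleton_ext_of_isTorsion h𝔪 hM (i + 1) (coker f) (fun d => ?_) d)
    exact subsingleton_ext_X₃ (shortExact_shift_coker f hf (-d)) (hY d) (hinj _ _ _)

end

/-! ### The object representing the only nonvanishing Ext functor -/

theorem isTorsion_quotient : (quotient 𝔪).IsTorsion 𝔪 :=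
  fun _ x => InSocle.isTorsionElement (inSocle_quotient 𝔪 x)

/-- Multiplication by `a` is a natural transformation between suspensions. -/
theorem shiftMap_mulHom {X Y : GrMod.{u, v} 𝒜} (f : X ⟶ Y) {e d d' : ℤ} (h : e + d = d')
    (a : 𝒜 e) : shiftMap (-d) f ≫ mulHom Y h a = mulHom X h a ≫ shiftMap (-d') f := by
  ext i x
  exact (hom_act f (show e + (i - -d) = i - -d' by omega) a x).symm

/-- The morphism of short exact sequences given by multiplication by `a`. -/
def mulHomShortComplex {X Y : GrMod.{u, v} 𝒜} (f : X ⟶ Y) {e d d' : ℤ} (h : e + d = d') (a : 𝒜 e) :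
    shiftCokerComplex f (-d) ⟶ shiftCokerComplex f (-d') where
  τ₁ := mulHom X h a
  τ₂ := mulHom Y h a
  τ₃ := mulHom (coker f) h a
  comm₁₂ := (shiftMap_mulHom f h a).symm
  comm₂₃ := (shiftMap_mulHom (cokerπ f) h a).symm

/-- Suppose that `Ext^i` from the residue field to the suspensions of `X` vanishes for `i ≠ n`.
Then `Ext^n(M, X)`, for torsion modules `M`, is represented by a module `Y`, via a universal class
`η ∈ Ext^n(Y, X)` (one for each suspension, compatible with multiplication by `A`). For `n > 0`,
one replaces `X` by `J ⧸ X`, where `J` is its injective hull: as `X` has no socle, neither has `J`,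
so all `Ext^i(M, J)` vanish, including `i = 0`. -/
theorem exists_universal_class (n : ℕ) : ∀ (X : GrMod.{u, u} 𝒜),
    (∀ i ≠ n, ∀ d, Subsingleton (Ext (quotient 𝔪) (shift (-d) X) i)) →
    ∃ (Y : GrMod.{u, u} 𝒜) (η : ∀ d : ℤ, Ext (shift (-d) Y) (shift (-d) X) n),
      (∀ {e d d' : ℤ} (h : e + d = d') (a : 𝒜 e),
        (η d).comp (Ext.mk₀ (mulHom X h a)) (add_zero n) =
          (Ext.mk₀ (mulHom Y h a)).comp (η d') (zero_add n)) ∧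
      (∀ M : GrMod.{u, u} 𝒜, M.IsTorsion 𝔪 → ∀ d : ℤ, Function.Bijective
        (fun f : M ⟶ shift (-d) Y => (Ext.mk₀ f).comp (η d) (zero_add n))) ∧
      ∀ i ≠ 0, ∀ d, Subsingleton (Ext (quotient 𝔪) (shift (-d) Y) i) := by
  induction n with
  | zero =>
    intro X hX
    refine ⟨X, fun d => Ext.mk₀ (𝟙 _), fun h a => by simp, fun M _ d => ?_, hX⟩
    simpa using Ext.mk₀_bijective _ _
  | succ n ih =>
    intro X hX
    obtain ⟨J, f, _, hf, hess⟩ := exists_injective_essential X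
    have hXsoc : SocleFree 𝔪 X := socleFree_of_subsingleton_ext (hX 0 (Nat.succ_ne_zero n).symm)
    have hJsoc : SocleFree 𝔪 J := by
      intro j z hz
      by_contra h0
      obtain ⟨e, k, h, a, x, hx, hne⟩ := hess j z h0
      refine hne ?_
      rw [← hx, hXsoc k x fun h' c hc => hf _ ?_, map_zero]
      rw [map_zero, hom_act, hx, act_act]
      exact hz _ _ (Ideal.mul_mem_right _ _ hc)
    have hJ (M : GrMod.{u, u} 𝒜) (hM : M.IsTorsion 𝔪) (d : ℤ) (i : ℕ) :
        Subsingleton (Ext M (shift (-d) J) i) := by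
      have := injective_shift J (-d)
      cases i with
      | zero => exact hJsoc.subsingleton_ext_zero hM _
      | succ i => exact Ext.subsingleton_of_injective ..
    have hS (d : ℤ) := shortExact_shift_coker f hf (-d)
    obtain ⟨Y, η, hη, hbij, hY⟩ := ih (coker f) fun i hi d =>
      subsingleton_ext_X₃ (hS d) (hX (i + 1) (by omega) d) (hJ _ isTorsion_quotient d i)
    refine ⟨Y, fun d => (η d).comp (hS d).extClass rfl, fun {e d d'} h a => ?_,
      fun M hM d => ?_, hY⟩
    · have hnat := (hS d).extClass_naturality (hS d') (mulHomShortComplex f h a)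
      rw [Ext.comp_assoc_of_third_deg_zero]
      refine (congrArg (fun t => (η d).comp t rfl) hnat).trans ?_
      rw [← Ext.comp_assoc_of_second_deg_zero]
      refine (congrArg (fun t => Ext.comp t (hS d').extClass rfl) (hη h a)).trans ?_
      exact Ext.comp_assoc _ _ _ _ _ (by omega)
    · have hcomp := (bijective_comp_extClass (W := M) (hS d) (hJ M hM d n)
        (hJ M hM d (n + 1))).comp (hbij M hM d)
      convert hcomp using 2 with g
      exact (Ext.comp_assoc _ _ _ _ _ (by omega)).symm

/-! ### Comparison with the injective hull of the residue field -/

/-- The submodule of torsion elements. -/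
def torsionSubmodule (𝔪 : HomogeneousIdeal 𝒜) (X : GrMod.{u, v} 𝒜) : GradedSubmodule X where
  carrier j :=
    { carrier := {x : X.obj j | IsTorsionElement 𝔪 X x}
      zero_mem' := ⟨0, fun _ _ _ => map_zero _⟩
      add_mem' := IsTorsionElement.add
      neg_mem' := IsTorsionElement.neg }
  act_mem h a _ hx := IsTorsionElement.act hx h a

/-- A morphism `t : Y ⟶ Z` identifies socles if it is injective on the socle of `Y` and every
nonzero homogeneous element of `Z` has a nonzero multiple in the image of the socle of `Y`. -/
structure IdentifiesSocles (𝔪 : HomogeneousIdeal 𝒜) {Y Z : GrMod.{u, v} 𝒜} (t : Y ⟶ Z) : Prop where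
  eq_zero : ∀ (j : ℤ) (y : Y.obj j), InSocle 𝔪 Y y → t.app j y = 0 → y = 0
  exists_act : ∀ (j : ℤ) (z : Z.obj j), z ≠ 0 → ∃ (e k : ℤ) (h : e + j = k) (a : 𝒜 e) (y : Y.obj k),
    InSocle 𝔪 Y y ∧ t.app k y = Z.act h a z ∧ Z.act h a z ≠ 0

theorem IdentifiesSocles.shiftMap {Y Z : GrMod.{u, v} 𝒜} {t : Y ⟶ Z} (ht : IdentifiesSocles 𝔪 t)
    (d : ℤ) : IdentifiesSocles 𝔪 (shiftMap d t) where
  eq_zero j y hy h0 := ht.eq_zero (j - d) y (fun {i k} h a ha => by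
    obtain ⟨k, rfl⟩ : ∃ l, k = l - d := ⟨k + d, by omega⟩
    exact hy (show i + j = k by omega) a ha) h0
  exists_act j z hz := by
    obtain ⟨e, k, h, a, y, hy, hz⟩ := ht.exists_act (j - d) z hz
    obtain ⟨k, rfl⟩ : ∃ l, k = l - d := ⟨k + d, by omega⟩
    exact ⟨e, k, by omega, a, y, fun h' c hc => hy _ c hc, hz⟩

/-- If `t : Y ⟶ Z` identifies socles and `Ext^1` from torsion modules to `Y` vanishes, then
morphisms from a torsion module to `Y` and to `Z` agree. For the surjectivity, a morphism
`g : M ⟶ Z` is lifted on the submodule `N` of those elements which it maps to `t (Γ Y)`, where `Γ Y`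
is the torsion submodule, and the lift is extended to `M`; a nonzero difference between `g` and the
result would have a nonzero value in the image of the socle of `Y` at an element of `N`. -/
theorem IdentifiesSocles.bijective_comp {Y Z M : GrMod.{u, u} 𝒜} {t : Y ⟶ Z}
    (ht : IdentifiesSocles 𝔪 t)
    (hY : ∀ M : GrMod.{u, u} 𝒜, M.IsTorsion 𝔪 → Subsingleton (Ext M Y 1))
    (hM : M.IsTorsion 𝔪) : Function.Bijective (fun g : M ⟶ Y => g ≫ t) := by
  have hinj (j : ℤ) (y : Y.obj j) (hy : IsTorsionElement 𝔪 Y y) (h0 : t.app j y = 0) : y = 0 := by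
    by_contra hne
    obtain ⟨_, k, _, _, hne', hs⟩ := hy.exists_inSocle hne
    exact hne' (ht.eq_zero k _ hs (by rw [hom_act, h0, map_zero]))
  have htor {X : GrMod.{u, u} 𝒜} (g : M ⟶ X) (j : ℤ) (x : M.obj j) :
      IsTorsionElement 𝔪 X (g.app j x) := IsTorsionElement.map (𝔪 := 𝔪) g (hM j x)
  refine ⟨fun g g' hgg' => ?_, fun g => ?_⟩
  · rw [← sub_eq_zero]
    ext j x
    refine hinj j _ (htor (g - g') j x) ?_
    have h0 : (g - g') ≫ t = 0 := by
      rw [Preadditive.sub_comp, sub_eq_zero]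
      exact hgg'
    exact congrArg (fun q : M ⟶ Z => q.app j x) h0
  · let Γ := torsionSubmodule 𝔪 Y
    let N : GradedSubmodule M :=
      { carrier := fun j => ((Γ.carrier j).map (t.app j)).comap (g.app j)
        act_mem := by
          rintro i j k h a x ⟨y, hy, hyx⟩
          refine ⟨_, Γ.act_mem h a hy, ?_⟩
          rw [hom_act, hom_act, hyx] }
    have hΓ (j : ℤ) : Function.Injective ((Γ.incl ≫ t).app j) :=
      (injective_iff_map_eq_zero _).2 fun y hy => Subtype.ext (hinj j y.1 y.2 hy)
    have hN (j : ℤ) (x : N.toGrMod.obj j) : ∃ y, (Γ.incl ≫ t).app j y = (N.incl ≫ g).app j x := by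
      obtain ⟨y, hy, hyx⟩ := x.2
      exact ⟨(⟨y, hy⟩ : Γ.carrier j), hyx⟩
    let l : N.toGrMod ⟶ Γ.toGrMod := liftOfInjective (Γ.incl ≫ t) hΓ (N.incl ≫ g) hN
    have hquot : (coker N.incl).IsTorsion 𝔪 := by
      intro j x
      obtain ⟨x, rfl⟩ := cokerπ_surjective N.incl j x
      exact htor (cokerπ N.incl) j x
    obtain ⟨h, hh⟩ := exists_extension (shortExact_of_app N.incl (cokerπ N.incl) N.incl_injective
      (cokerπ_surjective _) (comp_cokerπ _) fun i y hy => (cokerπ_app_eq_zero _ _).1 hy)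
      (hY _ hquot) (l ≫ Γ.incl)
    have hgh (j : ℤ) (x : M.obj j) (hx : x ∈ N.carrier j) : t.app j (h.app j x) = g.app j x := by
      have h₁ : h.app j x = Γ.incl.app j (l.app j ⟨x, hx⟩) :=
        congrArg (fun q : N.toGrMod ⟶ Y => q.app j ⟨x, hx⟩) hh
      rw [h₁]
      exact liftOfInjective_spec (Γ.incl ≫ t) hΓ (N.incl ≫ g) hN j ⟨x, hx⟩
    refine ⟨h, ?_⟩
    ext j x
    by_contra hne
    obtain ⟨e, k, h', a, y, hy, hyz, hne'⟩ := ht.exists_act j (g.app j x - t.app j (h.app j x))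
      (sub_ne_zero.2 (Ne.symm hne))
    rw [map_sub, ← hom_act, ← hom_act, ← hom_act] at hyz hne'
    refine hne' (sub_eq_zero.2 (hgh k _ ?_).symm)
    exact ⟨y + h.app k (M.act h' a x), hy.isTorsionElement.add (htor h k _), by
      rw [map_add, hyz, sub_add_cancel]⟩

/-- Essentiality of an injective hull, in terms of elements. -/
theorem IsInjectiveHull.exists_act {K I : GrMod.{u, v} 𝒜} {ι : K ⟶ I} (hι : IsInjectiveHull ι)
    {j : ℤ} {z : I.obj j} (hz : z ≠ 0) : ∃ (e k : ℤ) (h : e + j = k) (a : 𝒜 e) (x : K.obj k),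
      ι.app k x = I.act h a z ∧ I.act h a z ≠ 0 := by
  by_contra! H
  have := hι.mono
  let N := (⊥ : GradedSubmodule I).adjoin z
  have : Mono (cokerπ N.incl) := hι.essential _ <| mono_of_injective _ fun i => by
    rw [injective_iff_map_eq_zero]
    intro x hx
    obtain ⟨a, n, hn, hx⟩ := (N.cokerπ_incl_eq_zero _).1 hx
    rw [GradedSubmodule.mem_bot.1 hn, zero_add] at hx
    apply injective_of_mono ι i
    rw [map_zero, hx]
    exact H _ _ _ a x hx
  apply hz
  apply injective_of_mono (cokerπ N.incl) j
  rw [map_zero]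
  exact (N.cokerπ_incl_eq_zero z).2 (GradedSubmodule.mem_adjoin_self _ z)

theorem quotient_hom_eq_zero {X : GrMod.{u, u} 𝒜} (φ : quotient 𝔪 ⟶ X)
    (h : φ.app 0 (residueOne 𝔪) = 0) : φ = 0 := by
  ext i x
  obtain ⟨a, rfl⟩ := residueMap_surjective 𝔪 i x
  refine (congrArg (φ.app i) (residueMap_eq_act 𝔪 (a : 𝒜 i))).trans ?_
  refine (hom_act φ (add_zero i) a _).trans ?_
  rw [h, map_zero]
  rfl

theorem act_eq_zero_iff (X : GrMod.{u, v} 𝒜) {i j k l : ℤ} (h : i + j = k) (h' : i + j = l)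
    (a : 𝒜 i) (x : X.obj j) : X.act h a x = 0 ↔ X.act h' a x = 0 := by
  obtain rfl : k = l := by omega
  rfl

/-- Let `ι' : k ⟶ Σ^{-b} Y` be a morphism such that all morphisms `k ⟶ Σ^{-d} Y` are uniquely of the
form `c ι'` with `c` in the residue field. Then the extension of `k ⟶ I` along `ι'` identifies the
socles of `Y` and `Σ^b I`. -/
theorem exists_identifiesSocles {Y I : GrMod.{u, u} 𝒜} {ι : quotient 𝔪 ⟶ I}
    (hι : IsInjectiveHull ι) {b : ℤ} (ι' : quotient 𝔪 ⟶ shift (-b) Y)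
    (h₁ : ∀ (d : ℤ) (φ : quotient 𝔪 ⟶ shift (-d) Y), ∃ c : 𝒜 (d - b),
      φ = ι' ≫ mulHom Y (sub_add_cancel d b) c)
    (h₂ : ∀ (d : ℤ) (c : 𝒜 (d - b)), ι' ≫ mulHom Y (sub_add_cancel d b) c = 0 →
      (c : A) ∈ 𝔪.toIdeal) :
    ∃ f : Y ⟶ shift b I, IdentifiesSocles 𝔪 f := by
  have := hι.injective
  have := hι.mono
  have := injective_shift I b
  let w : Y.obj (0 - -b) := ι'.app 0 (residueOne 𝔪)
  let s : shift b (quotient 𝔪) ⟶ Y := shiftMap b ι' ≫ ofShiftShift Y (neg_add_cancel b)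
  have hs (j : ℤ) (c : 𝒜 (j - b)) : s.app j ((residueMap 𝔪).app (j - b) c) =
      Y.act (show j - b + (0 - -b) = j by omega) c w := by
    change Y.act _ (one 𝒜) (ι'.app (j - b) ((residueMap 𝔪).app (j - b) c)) = _
    rw [residueMap_eq_act, hom_act]
    exact Y.act_one_act _ _ _ _ _
  have : Mono s := mono_of_injective _ fun j => by
    rw [injective_iff_map_eq_zero]
    intro x hx
    obtain ⟨c, rfl⟩ := residueMap_surjective 𝔪 (j - b) x
    refine (residueMap_eq_zero 𝔪 (c : 𝒜 (j - b))).2 (h₂ j c (quotient_hom_eq_zero _ ?_))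
    exact (Y.act_eq_zero_iff _ _ _ _).1 ((hs j c).symm.trans hx)
  let f : Y ⟶ shift b I := Injective.factorThru (shiftMap b ι) s
  have hf (j : ℤ) (x : (quotient 𝔪).obj (j - b)) : f.app j (s.app j x) = ι.app (j - b) x :=
    congrArg (fun q : shift b (quotient 𝔪) ⟶ shift b I => q.app j x)
      (Injective.comp_factorThru (shiftMap b ι) s)
  refine ⟨f, fun j y hy h0 => ?_, fun j z hz => ?_⟩
  · obtain ⟨φ, hφ⟩ := hy.exists_hom
    obtain ⟨c, rfl⟩ := h₁ j φ
    have hy' : s.app j ((residueMap 𝔪).app (j - b) c) = y := by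
      apply Y.act_one_injective (show 0 + j = 0 - -j by omega)
      rw [hs, act_one_act _ _ _ (show j - b + (0 - -b) = 0 - -j by omega)]
      exact hφ 0 (one 𝒜)
    rw [← hy', hf] at h0
    rw [← hy']
    have h0' := injective_of_mono ι (j - b) (h0.trans (map_zero (ι.app (j - b))).symm)
    rw [h0']
    exact map_zero (s.app j)
  · obtain ⟨e, k, h, a, x, hx, hne⟩ := hι.exists_act (z := (z : I.obj (j - b))) hz
    obtain ⟨k, rfl⟩ : ∃ l, k = l - b := ⟨k + b, by omega⟩
    refine ⟨e, k, by omega, a, s.app k x, fun {i l} h' c hc => ?_, (hf k x).trans hx, hne⟩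
    exact (hom_act s h' c x).symm.trans
      ((congrArg (s.app l) (inSocle_quotient 𝔪 x (show i + (k - b) = l - b by omega) c hc)).trans
        (map_zero _))

end GrMod

theorem mainTheorem6 {A : Type u} [CommRing A] [IsNoetherianRing A]
    (𝒜 : ℤ → AddSubgroup A) [GradedRing 𝒜]
    (𝔪 : HomogeneousIdeal 𝒜) (h𝔪 : IsGradedLocal 𝔪)
    (n : ℕ) (b : ℤ) (hA : IsGradedGorenstein 𝔪 n b)
    (I : GrMod.{u, u} 𝒜) (ι : GrMod.quotient 𝔪 ⟶ I) (hI : GrMod.IsInjectiveHull ι)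
    (M : GrMod.{u, u} 𝒜) (hM : M.IsTorsion 𝔪) :
    (∀ i : ℕ, i ≠ n → ∀ d : ℤ, Subsingleton ((GrMod.gradedExt i M (GrMod.self 𝒜)).obj d)) ∧
      Nonempty (GrMod.Equiv (GrMod.gradedExt n M (GrMod.self 𝒜))
        (GrMod.shift b (GrMod.matlisDual I M))) := by
  refine ⟨fun i hi d => GrMod.subsingleton_ext_of_isTorsion h𝔪.1 hM i _ (hA.ext_eq_zero i hi) d, ?_⟩
  obtain ⟨Y, η, hη, hbij, hY⟩ := GrMod.exists_universal_class n (GrMod.self 𝒜) hA.ext_eq_zero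
  -- Composition with `η d`, as an isomorphism from `Hom` to `Ext^n`.
  let Θ (W : GrMod.{u, u} 𝒜) (hW : W.IsTorsion 𝔪) (d : ℤ) :
      (W ⟶ GrMod.shift (-d) Y) ≃+ (GrMod.gradedExt n W (GrMod.self 𝒜)).obj d :=
    AddEquiv.ofBijective (AddMonoidHom.mk'
      (fun f => (Abelian.Ext.mk₀ f).comp (η d) (zero_add n))
      (fun f g => by rw [Abelian.Ext.mk₀_add, Abelian.Ext.add_comp])) (hbij W hW d)
  have hΘ (W : GrMod.{u, u} 𝒜) (hW : W.IsTorsion 𝔪) {e d d' : ℤ} (h : e + d = d') (a : 𝒜 e)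
      (f : W ⟶ GrMod.shift (-d) Y) : Θ W hW d' (f ≫ GrMod.mulHom Y h a) =
        (GrMod.gradedExt n W (GrMod.self 𝒜)).act h a (Θ W hW d f) := by
    change (Abelian.Ext.mk₀ (f ≫ GrMod.mulHom Y h a)).comp (η d') (zero_add n) =
      ((Abelian.Ext.mk₀ f).comp (η d) (zero_add n)).comp
        (Abelian.Ext.mk₀ (GrMod.mulHom (GrMod.self 𝒜) h a)) (add_zero n)
    rw [Abelian.Ext.comp_assoc_of_third_deg_zero, hη h a, Abelian.Ext.mk₀_comp_mk₀_assoc]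
  obtain ⟨ε⟩ := hA.ext_equiv
  -- `ε ∘ Θ` identifies the morphisms `k ⟶ Σ^{-d} Y` with `k_{d - b}`.
  have hk := GrMod.isTorsion_quotient (𝔪 := 𝔪)
  let u₁ : (GrMod.shift b (GrMod.quotient 𝔪)).obj b := (GrMod.residueMap 𝔪).app (b - b)
    (⟨1, by rw [sub_self]; exact SetLike.GradedOne.one_mem⟩ : 𝒜 (b - b))
  let ι' := (Θ _ hk b).symm ((ε.app b).symm u₁)
  have hι' (d : ℤ) (c : 𝒜 (d - b)) :
      ε.app d (Θ _ hk d (ι' ≫ GrMod.mulHom Y (sub_add_cancel d b) c)) =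
        (GrMod.residueMap 𝔪).app (d - b) c := by
    rw [hΘ _ hk, ε.map_act, AddEquiv.apply_symm_apply, AddEquiv.apply_symm_apply]
    refine (GrMod.hom_act (GrMod.residueMap 𝔪) (show d - b + (b - b) = d - b by omega) c
      _).symm.trans ?_
    exact congrArg _ (Subtype.ext (mul_one (c : A)))
  obtain ⟨f, hf⟩ := GrMod.exists_identifiesSocles hI ι' (fun d φ => by
    obtain ⟨c, hc⟩ := GrMod.residueMap_surjective 𝔪 (d - b) (ε.app d (Θ _ hk d φ))
    exact ⟨c, (Θ _ hk d).injective ((ε.app d).injective (hc.symm.trans (hι' d c).symm))⟩)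
    (fun d c hc => (GrMod.residueMap_eq_zero 𝔪 c).1 ((hι' d c).symm.trans (by
      rw [hc, map_zero]
      exact map_zero (ε.app d))))
  -- The suspensions of `f`, which induce the isomorphism with the Matlis dual.
  let t (d : ℤ) : GrMod.shift (-d) Y ⟶ GrMod.shift (-(d - b)) I :=
    GrMod.shiftMap (-d) f ≫ (GrMod.shiftShiftIso I (show b + -d = -(d - b) by omega)).hom
  have ht {e d d' : ℤ} (h : e + d = d') (a : 𝒜 e) :
      GrMod.mulHom Y h a ≫ t d' = t d ≫ GrMod.mulHom I (show e + (d - b) = d' - b by omega) a := by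
    ext i y
    have h₁ := GrMod.hom_act f (show e + (i - -d) = i - -d' by omega) a y
    refine (congrArg _ h₁).trans ?_
    refine (I.act_one_act (show e + (i - -d - b) = i - -d' - b by omega) _
      (show e + (i - -d - b) = i - -(d' - b) by omega) a _).trans ?_
    exact (I.act_act_one _ _ _ a _).symm
  have htbij (d : ℤ) : Function.Bijective (fun g : M ⟶ GrMod.shift (-d) Y => g ≫ t d) := by
    have h₁ := (hf.shiftMap (-d)).bijective_comp (fun W hW =>
      GrMod.subsingleton_ext_of_isTorsion h𝔪.1 hW 1 Y (hY 1 one_ne_zero) d) hM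
    have h₂ := (Iso.homToEquiv (Z := M)
      (GrMod.shiftShiftIso I (show b + -d = -(d - b) by omega))).bijective.comp h₁
    convert h₂ using 2 with g
    exact (Category.assoc _ _ _).symm
  let Ξ (d : ℤ) : (M ⟶ GrMod.shift (-d) Y) ≃+ (GrMod.shift b (GrMod.matlisDual I M)).obj d :=
    AddEquiv.ofBijective (AddMonoidHom.mk' (fun g => g ≫ t d)
      (fun _ _ => Preadditive.add_comp _ _ _ _ _ _)) (htbij d)
  refine ⟨⟨fun d => (Θ M hM d).symm.trans (Ξ d), fun {i j k} h a x => ?_⟩⟩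
  obtain ⟨g, rfl⟩ := (Θ M hM j).surjective x
  rw [← hΘ M hM, AddEquiv.trans_apply, AddEquiv.trans_apply, AddEquiv.symm_apply_apply,
    AddEquiv.symm_apply_apply]
  change (g ≫ GrMod.mulHom Y h a) ≫ t k = (g ≫ t j) ≫ GrMod.mulHom I _ a
  rw [Category.assoc, Category.assoc, ht]
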